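/- Let the user equipments (UEs) be located at the points $X_i$ of a homogeneous Poisson point process in $\mathbb R^2$ of intensity $\lambda>0$. Independently of the locations, the UEs carry i.i.d. mark vectors with independent components: a type indicator $\varrho_i$ with $\mathrm P(\varrho_i=1)=q\in[0,1]$ (potential D2D UE); a D2D link length $L_i$ with Rayleigh density $2\pi\xi x\,e^{-\xi\pi x^2}$, $x\ge 0$, where $\xi>0$; an ALOHA indicator $e_i$ with $\mathrm P(e_i=1)=\varepsilon\in[0,1]$; and a fading coefficient $G_i$. A potential D2D UE operates in D2D mode if $L_i\le\theta$, where $\theta>0$, and it then transmits with power $L_i^{\tau_d}$ (channel inversion), where $\tau_d>2$ is the path-loss exponent. The interference at a D2D receiver at the origin is $$I_d=\sum_{i:\ \varrho_i=1,\ L_i\le\theta,\ e_i=1,\ X_i\ne 0} L_i^{\tau_d}\,G_i\,\|X_i\|^{-\tau_d}.$$ Let $\bar w>0$, $\delta_d=2/\tau_d$, $\hat\xi=\xi/\gamma(2,\xi\pi\theta^2)$ with $\gamma(a,x)=\int_0^x t^{a-1}e^{-t}\,dt$, $\mathrm{sinc}(x)=\frac{\sin \pi x}{\pi x}$, $\binom{x}{y}=\frac{\Gamma(x+1)}{\Gamma(y+1)\Gamma(x-y+1)}$,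 and let $\mathrm I_\nu$ be the modified Bessel function of the first kind. Suppose that one of the following holds. (a) ($\kappa$-$\mu$ fading, $\kappa,\mu>0$) $G_i$ has on $(0,\infty)$ the density $$f(x)=\frac{\mu}{\kappa^{\frac{\mu-1}2}e^{\mu\kappa}}\Big(\frac{1+\kappa}{\bar w}\Big)^{\frac{\mu+1}2}x^{\frac{\mu-1}2}e^{-\frac{\mu(1+\kappa)}{\bar w}x}\,\mathrm I_{\mu-1}\Big(2\mu\sqrt{\tfrac{\kappa(1+\kappa)}{\bar w}x}\Big),$$ and $$c=\frac{q\varepsilon\lambda}{\hat\xi e^{\mu\kappa}}\cdot\frac{{}_1F_1(\mu+\delta_d;\mu;\mu\kappa)}{\mathrm{sinc}(\delta_d)}\cdot\Big(\frac{\bar w}{(1+\kappa)\mu}\Big)^{\delta_d}\cdot\binom{\mu+\delta_d-1}{\delta_d}.$$ (b) ($\eta$-$\mu$ fading, $\eta,\mu>0$) With $h=\frac{2+\eta^{-1}+\eta}4$ and $H=\frac{\eta^{-1}-\eta}4$, $G_i$ has on $(0,\infty)$ the density $$f(x)=\frac{2\sqrt\pi\,\mu^{\mu+\frac12}h^\mu}{\Gamma(\mu)H^{\mu-\frac12}\bar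 w^{\mu+\frac12}}x^{\mu-\frac12}e^{-\frac{2\mu hx}{\bar w}}\,\mathrm I_{\mu-\frac12}\Big(\frac{2\mu Hx}{\bar w}\Big),$$ where $H^{-(\mu-\frac12)}\mathrm I_{\mu-\frac12}(2\mu Hx/\bar w)$ is read as the even entire function of $H$ that it defines (so that $\eta\ge1$ is included), and $$c=\frac{q\varepsilon\lambda}{\hat\xi h^{\mu}}\cdot\frac{{}_2F_1\big(\mu+\frac{\delta_d}2+\frac12,\ \mu+\frac{\delta_d}2;\ \mu+\frac12;\ (H/h)^2\big)}{\mathrm{sinc}(\delta_d)}\cdot\Big(\frac{\bar w}{2\mu h}\Big)^{\delta_d}\cdot\binom{2\mu+\delta_d-1}{\delta_d}.$$ Then $\mathbb E[G_i]=\bar w$ for every $i$, the series $I_d$ converges almost surely, and $$\mathcal L_{I_d}(s)=\mathbb E\big[e^{-sI_d}\big]=\exp\big(-c\,s^{\delta_d}\big)\qquad\text{for all } s\ge 0.$$ -/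

import Mathlib

open MeasureTheory ProbabilityTheory
open scoped unitInterval Nat

namespace D2D

noncomputable section

/-! ### Special functions -/

/-- Kummer's confluent hypergeometric function `₁F₁(a; b; x) = ∑ₙ (a)ₙ / (b)ₙ · xⁿ / n!`. -/
def kummer (a b x : ℝ) : ℝ :=
  ∑' n : ℕ, (ascPochhammer ℝ n).eval a / (ascPochhammer ℝ n).eval b * x ^ n / (n ! : ℝ)

/-- The even entire factor `∑ₙ (x²/4)ⁿ / (n! Γ(ν+n+1))` of the modified Bessel function of the
first kind, i.e. `I_ν(x) / (x/2)^ν`. -/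
def besselIFactor (ν x : ℝ) : ℝ :=
  ∑' n : ℕ, (x ^ 2 / 4) ^ n / ((n ! : ℝ) * Real.Gamma (ν + n + 1))

/-- The modified Bessel function of the first kind `I_ν(x)`, for `x > 0`. -/
def besselI (ν x : ℝ) : ℝ := (x / 2) ^ ν * besselIFactor ν x

/-- The lower incomplete gamma function `γ(a, x) = ∫₀ˣ t^(a-1) e^(-t) dt`. -/
def lowerGamma (a x : ℝ) : ℝ := ∫ t in (0 : ℝ)..x, t ^ (a - 1) * Real.exp (-t)

/-- The generalized binomial coefficient `Γ(x+1) / (Γ(y+1) Γ(x-y+1))`. -/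
def realBinom (x y : ℝ) : ℝ :=
  Real.Gamma (x + 1) / (Real.Gamma (y + 1) * Real.Gamma (x - y + 1))

/-- The normalized cardinal sine `sin(π x) / (π x)`. -/
def nsinc (x : ℝ) : ℝ := Real.sinc (Real.pi * x)

/-! ### Distributions of the link length and of the fading -/

/-- The law on `(0, ∞)` with Lebesgue density `f`. -/
def lawOfDensity (f : ℝ → ℝ) : Measure ℝ :=
  (volume.restrict (Set.Ioi 0)).withDensity fun x => ENNReal.ofReal (f x)

/-- The Rayleigh law of the D2D link length, density `2 π ξ x e^(-ξ π x²)`. -/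
def linkLaw (ξ : ℝ) : Measure ℝ :=
  lawOfDensity fun x => 2 * Real.pi * ξ * x * Real.exp (-(ξ * Real.pi * x ^ 2))

/-- The density of the power coefficient of `κ-μ` fading, with mean parameter `w`. -/
def kappaMuPDF (κ μ w x : ℝ) : ℝ :=
  μ / (κ ^ ((μ - 1) / 2) * Real.exp (μ * κ)) * ((1 + κ) / w) ^ ((μ + 1) / 2)
    * x ^ ((μ - 1) / 2) * Real.exp (-(μ * (1 + κ) / w * x))
    * besselI (μ - 1) (2 * μ * √(κ * (1 + κ) / w * x))

/-- The `κ-μ` fading law. -/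
def kappaMuLaw (κ μ w : ℝ) : Measure ℝ := lawOfDensity (kappaMuPDF κ μ w)

/-- `h = (2 + η⁻¹ + η) / 4`. -/
def etaSmallH (η : ℝ) : ℝ := (2 + η⁻¹ + η) / 4

/-- `H = (η⁻¹ - η) / 4`. -/
def etaBigH (η : ℝ) : ℝ := (η⁻¹ - η) / 4

/-- The density of the power coefficient of `η-μ` fading, with mean parameter `w`. The usual
expression contains `I_{μ-1/2}(2μHx/w) / H^(μ-1/2)`, which is an even entire function of `H`;
it is written here as `(μx/w)^(μ-1/2)` times the Bessel factor, so that `H = 0` (`η = 1`) and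
`H < 0` (`η > 1`) are covered as well. For `H > 0` see `etaMuPDF_eq`. -/
def etaMuPDF (η μ w x : ℝ) : ℝ :=
  2 * √Real.pi * μ ^ (μ + 1 / 2) * etaSmallH η ^ μ / (Real.Gamma μ * w ^ (μ + 1 / 2))
    * x ^ (μ - 1 / 2) * Real.exp (-(2 * μ * etaSmallH η * x / w))
    * ((μ * x / w) ^ (μ - 1 / 2) * besselIFactor (μ - 1 / 2) (2 * μ * etaBigH η * x / w))

/-- The usual form of the `η-μ` density. -/
theorem etaMuPDF_eq {η μ w x : ℝ} (hη : 0 < η) (hη1 : η < 1) (hμ : 0 < μ) (hw : 0 < w)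
    (hx : 0 < x) :
    etaMuPDF η μ w x =
      2 * √Real.pi * μ ^ (μ + 1 / 2) * etaSmallH η ^ μ
        / (Real.Gamma μ * etaBigH η ^ (μ - 1 / 2) * w ^ (μ + 1 / 2))
        * x ^ (μ - 1 / 2) * Real.exp (-(2 * μ * etaSmallH η * x / w))
        * besselI (μ - 1 / 2) (2 * μ * etaBigH η * x / w) := by
  have hH : 0 < etaBigH η := by
    have : 1 < η⁻¹ := (one_lt_inv₀ hη).2 hη1
    unfold etaBigH
    linarith
  have h1 : 2 * μ * etaBigH η * x / w / 2 = etaBigH η * (μ * x / w) := by ring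
  have h2 : etaBigH η ^ (μ - 1 / 2) ≠ 0 := (Real.rpow_pos_of_pos hH _).ne'
  unfold etaMuPDF besselI
  rw [h1, Real.mul_rpow hH.le (by positivity)]
  have h3 : Real.Gamma μ ≠ 0 := (Real.Gamma_pos_of_pos hμ).ne'
  have h4 : w ^ (μ + 1 / 2) ≠ 0 := (Real.rpow_pos_of_pos hw _).ne'
  field_simp

/-- The `η-μ` fading law. -/
def etaMuLaw (η μ w : ℝ) : Measure ℝ := lawOfDensity (etaMuPDF η μ w)

/-! ### The network model -/

/-- The plane with its Euclidean norm. -/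
abbrev Plane : Type := EuclideanSpace ℝ (Fin 2)

section Model

variable {Ω : Type*} [MeasurableSpace Ω]

/-- The number of points of the random configuration `{Xᵢ}` in the set `B`. -/
def pointCount (X : ℕ → Ω → Plane) (B : Set Plane) (ω : Ω) : ℕ∞ :=
  Set.encard {i | X i ω ∈ B}

/-- `{Xᵢ}` is a homogeneous Poisson point process in the plane with intensity `lam`: the number of
points in a Borel set `B` of finite area is Poisson with mean `lam · |B|`, and the numbers of
points in disjoint such sets are independent. -/
structure IsHomogeneousPPP (lam : ℝ) (X : ℕ → Ω → Plane) (P : Measure Ω) : Prop where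
  measurable : ∀ i, Measurable (X i)
  count_law : ∀ B : Set Plane, MeasurableSet B → volume B ≠ ⊤ →
    HasLaw (pointCount X B)
      ((poissonMeasure (lam * volume.real B).toNNReal).map (Nat.cast : ℕ → ℕ∞)) P
  count_indep : ∀ (n : ℕ) (B : Fin n → Set Plane),
    (∀ k, MeasurableSet (B k)) → (∀ k, volume (B k) ≠ ⊤) → Pairwise (Function.onFun Disjoint B) →
    iIndepFun (fun k => pointCount X (B k)) P

/-- The independently marked Poisson network. The UEs are located at the points `Xᵢ` of a
homogeneous Poisson point process of intensity `lam`, and the `i`-th UE carries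
* `ty i`: whether it is a potential D2D UE (probability `q`) or a cellular one;
* `L i`: its D2D link length, Rayleigh with parameter `ξ`;
* `tx i`: whether ALOHA lets it transmit in the slot (probability `ε`);
* `G i`: the fading coefficient, with law `fading`, of its channel to the receiver at the origin.

The four marks of a UE are independent (their joint law is the product), the mark vectors of
different UEs are independent, and the marks are independent of the locations. -/
structure IsNetwork (lam : ℝ) (q ε : I) (ξ : ℝ) (fading : Measure ℝ) (X : ℕ → Ω → Plane)
    (ty : ℕ → Ω → Bool) (L : ℕ → Ω → ℝ) (tx : ℕ → Ω → Bool) (G : ℕ → Ω → ℝ)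
    (P : Measure Ω) : Prop where
  ppp : IsHomogeneousPPP lam X P
  measurable_ty : ∀ i, Measurable (ty i)
  measurable_L : ∀ i, Measurable (L i)
  measurable_tx : ∀ i, Measurable (tx i)
  measurable_G : ∀ i, Measurable (G i)
  mark_law : ∀ i, HasLaw (fun ω => (ty i ω, L i ω, tx i ω, G i ω))
    ((bernoulliMeasure true false q).prod
      ((linkLaw ξ).prod ((bernoulliMeasure true false ε).prod fading))) P
  mark_indep : iIndepFun (fun i ω => (ty i ω, L i ω, tx i ω, G i ω)) P
  mark_indep_location :
    IndepFun (fun ω i => X i ω) (fun ω i => (ty i ω, L i ω, tx i ω, G i ω)) P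

/-- The indices of the interfering UEs: the potential D2D UEs that select the D2D mode (link length
at most `θ`), are granted a transmission by ALOHA, and are not located at the origin. -/
def interferers (θ : ℝ) (X : ℕ → Ω → Plane) (ty : ℕ → Ω → Bool) (L : ℕ → Ω → ℝ)
    (tx : ℕ → Ω → Bool) (ω : Ω) : Set ℕ :=
  {i | ty i ω = true ∧ L i ω ≤ θ ∧ tx i ω = true ∧ X i ω ≠ 0}

/-- The power received at the origin from the `i`-th UE when it transmits in D2D mode: the transmit
power `L ^ τ` (channel inversion), times the fading coefficient, times the path loss. -/
def receivedPower (τ : ℝ) (X : ℕ → Ω → Plane) (L G : ℕ → Ω → ℝ) (ω : Ω) (i : ℕ) : ℝ :=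
  L i ω ^ τ * G i ω * ‖X i ω‖ ^ (-τ)

/-- The interference `I_d` at a D2D receiver at the origin. -/
def interference (τ θ : ℝ) (X : ℕ → Ω → Plane) (ty : ℕ → Ω → Bool) (L : ℕ → Ω → ℝ)
    (tx : ℕ → Ω → Bool) (G : ℕ → Ω → ℝ) (ω : Ω) : ℝ :=
  ∑' i : interferers θ X ty L tx ω, receivedPower τ X L G ω i

/-- The Laplace transform `E[e^(-s Y)]` of a random variable. -/
def laplaceTransform (Y : Ω → ℝ) (P : Measure Ω) (s : ℝ) : ℝ := ∫ ω, Real.exp (-s * Y ω) ∂P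

end Model

/-! ### The constants -/

/-- `ξ̂ = ξ / γ(2, ξ π θ²)`. -/
def xiHat (ξ θ : ℝ) : ℝ := ξ / lowerGamma 2 (ξ * Real.pi * θ ^ 2)

/-- The constant for `κ-μ` fading, with `δ = 2/τ`. -/
def cKappaMu (lam q ε ξ θ κ μ w δ : ℝ) : ℝ :=
  q * ε * lam / (xiHat ξ θ * Real.exp (μ * κ)) * (kummer (μ + δ) μ (μ * κ) / nsinc δ)
    * (w / ((1 + κ) * μ)) ^ δ * realBinom (μ + δ - 1) δ

/-- The constant for `η-μ` fading, with `δ = 2/τ`. -/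
def cEtaMu (lam q ε ξ θ η μ w δ : ℝ) : ℝ :=
  q * ε * lam / (xiHat ξ θ * etaSmallH η ^ μ)
    * (ordinaryHypergeometric (μ + δ / 2 + 1 / 2) (μ + δ / 2) (μ + 1 / 2)
        ((etaBigH η / etaSmallH η) ^ 2) / nsinc δ)
    * (w / (2 * μ * etaSmallH η)) ^ δ * realBinom (2 * μ + δ - 1) δ

end

end D2D

/-! The interference is power-law shot noise over an independently marked Poisson process, so its
Laplace transform is that of a one-sided stable law of index `δ = 2/τ`. If `p` denotes the mark
power (transmit power times fading, zero for silent UEs), the Laplace functional gives `E[e^(-sI)] =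
exp(-lam ∫ E[1 - e^(-s p ‖x‖^(-τ))] dx)`. Integrating over the plane for a fixed mark yields `π
Γ(1-δ) s^δ p^δ`, so only the moment `E[p^δ]` is left. It factorises over the four independent marks.
Channel inversion turns `(L^τ)^δ` into `L²`, whose truncated mean is `γ(2, ξπθ²)/(ξπ)`; this
produces `ξ̂`. See `IsHomogeneousPPP.lintegral_expNeg_tsum_marked`,
`lintegral_one_sub_expNeg_pathLoss` and `lintegral_markPower_rpow`.

The fading moments come from expanding the Bessel factor in its power series: both fading laws are
mixtures of gamma laws with a common rate, with Poisson weights for `κ-μ` and negative binomial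
weights for `η-μ`. Summing the gamma moments produces `₁F₁` and `₂F₁`
(`lintegral_rpow_gammaMixture`). The order `p = δ` gives the constant and `p = 1` gives the mean
`w`. The reflection formula matches `Γ(1-δ)` with the sinc and the binomial coefficient.

Sums and integrals are taken in `[0, ∞]` with `expNeg ⊤ = 0`, so the Laplace transform is known
before convergence is. Letting `s → 0+` then shows that the sum is almost surely finite, and only
afterwards is it identified with the real-valued interference. -/

open Filter Topology
open scoped ENNReal NNReal

namespace D2D

/-! ### The exponential on `[0, ∞]` and Poisson counts -/

/-- The function `x ↦ e^(-x)` on `[0, ∞]`, with value `0` at `∞`. -/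
noncomputable def expNeg (x : ℝ≥0∞) : ℝ≥0∞ := EReal.exp (-(x : EReal))

theorem expNeg_zero : expNeg 0 = 1 := by simp [expNeg]

theorem expNeg_top : expNeg ⊤ = 0 := by simp [expNeg]

theorem expNeg_add (x y : ℝ≥0∞) : expNeg (x + y) = expNeg x * expNeg y := by
  unfold expNeg
  rw [← EReal.exp_add, EReal.coe_ennreal_add, EReal.neg_add, sub_eq_add_neg]
  · exact Or.inl (by simp)
  · exact Or.inr (by simp)

theorem expNeg_ofReal {r : ℝ} (hr : 0 ≤ r) :
    expNeg (ENNReal.ofReal r) = ENNReal.ofReal (Real.exp (-r)) := by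
  rw [expNeg, EReal.coe_ennreal_ofReal, max_eq_left hr, ← EReal.coe_neg, EReal.exp_coe]

theorem expNeg_antitone : Antitone expNeg := fun _ _ h =>
  EReal.exp_monotone (EReal.neg_le_neg_iff.2 (EReal.coe_ennreal_le_coe_ennreal_iff.2 h))

theorem expNeg_le_one (x : ℝ≥0∞) : expNeg x ≤ 1 := by
  rw [← expNeg_zero]; exact expNeg_antitone zero_le

theorem expNeg_ne_top (x : ℝ≥0∞) : expNeg x ≠ ⊤ :=
  ((expNeg_le_one x).trans_lt ENNReal.one_lt_top).ne

theorem continuous_expNeg : Continuous expNeg :=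
  ENNReal.continuous_exp.comp (continuous_neg.comp continuous_coe_ennreal_ereal)

@[fun_prop]
theorem measurable_expNeg : Measurable expNeg := continuous_expNeg.measurable

theorem expNeg_sum {ι : Type*} (s : Finset ι) (f : ι → ℝ≥0∞) :
    expNeg (∑ i ∈ s, f i) = ∏ i ∈ s, expNeg (f i) := by
  classical
  induction s using Finset.induction_on with
  | empty => simp [expNeg_zero]
  | insert a s ha ih => rw [Finset.sum_insert ha, Finset.prod_insert ha, expNeg_add, ih]

/-- Every number of `[0, 1]` is a value of `expNeg`. -/
theorem expNeg_neg_log {x : ℝ≥0∞} (hx : x ≤ 1) : expNeg (-(ENNReal.log x)).toENNReal = x := by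
  have h : 0 ≤ -(ENNReal.log x) := by
    rw [EReal.neg_nonneg]
    simpa using ENNReal.log_monotone hx
  rw [expNeg, EReal.coe_toENNReal h, neg_neg, ENNReal.exp_log]

/-- The Laplace transform of a Poisson law. -/
theorem lintegral_expNeg_mul_poisson (r : ℝ≥0) {a : ℝ≥0∞} (ha : a ≠ ⊤) :
    ∫⁻ n, expNeg (a * (n : ℝ≥0∞)) ∂((poissonMeasure r).map (Nat.cast : ℕ → ℕ∞)) =
      expNeg (r * (1 - expNeg a)) := by
  obtain ⟨b, hb, rfl⟩ : ∃ b : ℝ, 0 ≤ b ∧ a = ENNReal.ofReal b :=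
    ⟨a.toReal, ENNReal.toReal_nonneg, (ENNReal.ofReal_toReal ha).symm⟩
  have hterm : ∀ n : ℕ, ENNReal.ofReal (Real.exp (-r) * r ^ n / n !) *
      expNeg (ENNReal.ofReal b * (n : ℝ≥0∞)) =
        ENNReal.ofReal (Real.exp (-r) * ((r * Real.exp (-b)) ^ n / n !)) := by
    intro n
    rw [← ENNReal.ofReal_natCast, ← ENNReal.ofReal_mul hb, expNeg_ofReal (by positivity),
      ← ENNReal.ofReal_mul (by positivity), mul_pow, ← Real.exp_nat_mul]
    congr 1
    rw [show -(b * n) = n * -b by ring]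
    ring
  have hs : HasSum (fun n : ℕ => Real.exp (-r) * ((r * Real.exp (-b)) ^ n / n !))
      (Real.exp (-r) * Real.exp (r * Real.exp (-b))) := by
    have := (NormedSpace.expSeries_div_hasSum_exp ((r : ℝ) * Real.exp (-b))).mul_left
      (Real.exp (-r))
    rwa [← Real.exp_eq_exp_ℝ] at this
  have h1 : Real.exp (-b) ≤ 1 := Real.exp_le_one_iff.2 (by linarith)
  rw [lintegral_map (by fun_prop) .of_discrete, poissonMeasure, lintegral_sum_measure]
  simp_rw [lintegral_smul_measure, lintegral_dirac, smul_eq_mul, ENat.toENNReal_coe, hterm]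
  rw [← ENNReal.ofReal_tsum_of_nonneg (fun n => by positivity) hs.summable, hs.tsum_eq,
    expNeg_ofReal hb, ← ENNReal.ofReal_one, ← ENNReal.ofReal_sub _ (by positivity),
    ← ENNReal.ofReal_coe_nnreal, ← ENNReal.ofReal_mul NNReal.zero_le_coe,
    expNeg_ofReal (mul_nonneg NNReal.zero_le_coe (by linarith)), ← Real.exp_add]
  congr 2
  ring

/-- Links the two descriptions of the process: the hypotheses speak of counts, whereas shot noise is
a sum over points. -/
theorem pointCount_toENNReal {Ω : Type*} (X : ℕ → Ω → Plane) (B : Set Plane) (ω : Ω) :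
    (pointCount X B ω : ℝ≥0∞) = ∑' i, B.indicator 1 (X i ω) := by
  rw [pointCount, ← ENNReal.tsum_set_one, tsum_subtype {i | X i ω ∈ B} (fun _ => (1 : ℝ≥0∞))]
  rfl

/-! ### Laplace functional of a Poisson process -/

section LaplaceFunctional

variable {Ω : Type*} [MeasurableSpace Ω]

theorem measurable_pointCount_toENNReal {X : ℕ → Ω → Plane} (hX : ∀ i, Measurable (X i))
    {B : Set Plane} (hB : MeasurableSet B) :
    Measurable fun ω => (pointCount X B ω : ℝ≥0∞) := by
  simp_rw [pointCount_toENNReal]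
  exact Measurable.tsum fun i => (measurable_one.indicator hB).comp (hX i)

/-- The Laplace functional of a Poisson process at a step function. -/
theorem IsHomogeneousPPP.lintegral_expNeg_sum_pointCount {lam : ℝ} {X : ℕ → Ω → Plane}
    {P : Measure Ω} (h : IsHomogeneousPPP lam X P) (hlam : 0 ≤ lam) {n : ℕ}
    (a : Fin n → ℝ≥0∞) (ha : ∀ k, a k ≠ ⊤) (B : Fin n → Set Plane)
    (hB : ∀ k, MeasurableSet (B k)) (hB' : ∀ k, volume (B k) ≠ ⊤)
    (hd : Pairwise (Function.onFun Disjoint B)) :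
    ∫⁻ ω, expNeg (∑ k, a k * pointCount X (B k) ω) ∂P =
      expNeg (ENNReal.ofReal lam * ∑ k, (1 - expNeg (a k)) * volume (B k)) := by
  simp_rw [expNeg_sum, Finset.mul_sum]
  rw [lintegral_prod_eq_prod_lintegral_of_indepFun Finset.univ
    (fun k ω => expNeg (a k * pointCount X (B k) ω))
    ((h.count_indep n B hB hB' hd).comp (fun k c => expNeg (a k * (c : ℝ≥0∞)))
      fun k => .of_discrete)
    fun k => measurable_expNeg.comp
      ((measurable_pointCount_toENNReal h.measurable (hB k)).const_mul _), expNeg_sum]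
  refine Finset.prod_congr rfl fun k _ => ?_
  rw [(h.count_law (B k) (hB k) (hB' k)).lintegral_comp
    (f := fun c : ℕ∞ => expNeg (a k * (c : ℝ≥0∞))) .of_discrete,
    lintegral_expNeg_mul_poisson _ (ha k)]
  congr 1
  -- `ENNReal.ofReal r` is by definition the coercion of `r.toNNReal`, the parameter of the Poisson
  -- law.
  change ENNReal.ofReal (lam * volume.real (B k)) * _ = _
  rw [ENNReal.ofReal_mul hlam, measureReal_def, ENNReal.ofReal_toReal (hB' k)]
  ring

/-- The fibres over the nonzero values are disjoint and lie in the support, hence have finite area,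
so the step-function formula applies to them. The value `0` has to be left out because its fibre has
infinite area; it contributes nothing to either side. -/
theorem IsHomogeneousPPP.lintegral_expNeg_simpleFunc {lam : ℝ} {X : ℕ → Ω → Plane}
    {P : Measure Ω} (h : IsHomogeneousPPP lam X P) (hlam : 0 ≤ lam)
    (f : SimpleFunc Plane ℝ≥0∞) (hf : ∀ x, f x ≠ ⊤) (hf' : volume (Function.support f) ≠ ⊤) :
    ∫⁻ ω, expNeg (∑' i, f (X i ω)) ∂P =
      expNeg (ENNReal.ofReal lam * ∫⁻ x, (1 - expNeg (f x))) := by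
  classical
  set s : Finset ℝ≥0∞ := f.range.filter (· ≠ 0)
  let e := s.equivFin.symm
  have hmem : ∀ k, (e k : ℝ≥0∞) ∈ f.range ∧ (e k : ℝ≥0∞) ≠ 0 := fun k =>
    Finset.mem_filter.1 (e k).2
  -- Needed for two choices of `F`: the identity for the sum over the points, and `y ↦ 1 - expNeg y`
  -- for the area integral.
  have hsum : ∀ (F : ℝ≥0∞ → ℝ≥0∞), F 0 = 0 → ∀ x, F (f x) =
      ∑ k, F (e k) * (f ⁻¹' {(e k : ℝ≥0∞)}).indicator 1 x := by
    intro F hF x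
    rw [Equiv.sum_comp e (fun y : s => F y * (f ⁻¹' {(y : ℝ≥0∞)}).indicator 1 x),
      Finset.sum_coe_sort s (fun y : ℝ≥0∞ => F y * (f ⁻¹' {y}).indicator 1 x)]
    by_cases hx : f x = 0
    · rw [hx, hF, Finset.sum_eq_zero]
      intro y hy
      rw [Set.indicator_of_notMem, mul_zero]
      simp only [Set.mem_preimage, Set.mem_singleton_iff, hx]
      exact fun h0 => (Finset.mem_filter.1 hy).2 h0.symm
    · rw [Finset.sum_eq_single (f x)]
      · simp
      · intro y _ hy
        rw [Set.indicator_of_notMem, mul_zero]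
        simpa using hy.symm
      · intro hx'
        exact absurd (Finset.mem_filter.2 ⟨f.mem_range_self x, hx⟩) hx'
  have hB : ∀ k, MeasurableSet (f ⁻¹' {(e k : ℝ≥0∞)}) := fun k => f.measurableSet_fiber _
  have hfin : ∀ k, volume (f ⁻¹' {(e k : ℝ≥0∞)}) ≠ ⊤ := fun k => by
    refine ne_top_of_le_ne_top hf' (measure_mono fun x hx => ?_)
    rw [Function.mem_support, show f x = e k from hx]
    exact (hmem k).2
  have key := h.lintegral_expNeg_sum_pointCount hlam (fun k => (e k : ℝ≥0∞))
    (fun k => by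
      obtain ⟨x, hx⟩ := SimpleFunc.mem_range.1 (hmem k).1
      exact hx ▸ hf x)
    (fun k => f ⁻¹' {(e k : ℝ≥0∞)}) hB hfin
    (fun k l hkl => Set.disjoint_left.2 fun x hx hx' =>
      hkl (e.injective (Subtype.ext ((show f x = e k from hx).symm.trans hx'))))
  have h1 : ∀ ω, ∑' i, f (X i ω) = ∑ k, (e k : ℝ≥0∞) *
      pointCount X (f ⁻¹' {(e k : ℝ≥0∞)}) ω := by
    intro ω
    simp_rw [pointCount_toENNReal, ← ENNReal.tsum_mul_left]
    rw [← Summable.tsum_finsetSum fun _ _ => ENNReal.summable]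
    exact tsum_congr fun i => hsum id rfl _
  have h2 : ∫⁻ x, (1 - expNeg (f x)) =
      ∑ k, (1 - expNeg (e k)) * volume (f ⁻¹' {(e k : ℝ≥0∞)}) := by
    simp_rw [hsum (fun y => 1 - expNeg y) (by simp [expNeg_zero])]
    rw [lintegral_finsetSum _ fun k _ => (measurable_one.indicator (hB k)).const_mul _]
    refine Finset.sum_congr rfl fun k _ => ?_
    rw [lintegral_const_mul _ (measurable_one.indicator (hB k)), lintegral_indicator_one (hB k)]
  simp_rw [h1, h2]
  exact key

/-- The Laplace functional of a homogeneous Poisson point process. -/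
theorem IsHomogeneousPPP.lintegral_expNeg_tsum {lam : ℝ} {X : ℕ → Ω → Plane}
    {P : Measure Ω} [IsFiniteMeasure P] (h : IsHomogeneousPPP lam X P) (hlam : 0 ≤ lam)
    {g : Plane → ℝ≥0∞} (hg : Measurable g) :
    ∫⁻ ω, expNeg (∑' i, g (X i ω)) ∂P =
      expNeg (ENNReal.ofReal lam * ∫⁻ x, (1 - expNeg (g x))) := by
  -- Simple approximations from below, cut off to balls so that their supports have finite area.
  let f : ℕ → SimpleFunc Plane ℝ≥0∞ := fun n =>
    (SimpleFunc.eapprox g n).restrict (Metric.ball 0 n)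
  have hfx : ∀ n x, f n x = (Metric.ball (0 : Plane) n).indicator (SimpleFunc.eapprox g n) x :=
    fun n x => by rw [SimpleFunc.restrict_apply _ measurableSet_ball]
  have hmono : ∀ x, Monotone fun n => f n x := by
    intro x m n hmn
    simp only [hfx]
    refine (Set.indicator_le_indicator (SimpleFunc.monotone_eapprox g hmn x)).trans ?_
    exact Set.indicator_le_indicator_of_subset
      (Metric.ball_subset_ball (by exact_mod_cast hmn)) (fun _ => zero_le) x
  have hlim : ∀ x, Tendsto (fun n => f n x) atTop (𝓝 (g x)) := by
    intro x
    refine (SimpleFunc.tendsto_eapprox hg x).congr' ?_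
    obtain ⟨N, hN⟩ := exists_nat_gt ‖x‖
    filter_upwards [eventually_ge_atTop N] with n hn
    rw [hfx, Set.indicator_of_mem]
    rw [mem_ball_zero_iff]
    exact hN.trans_le (by exact_mod_cast hn)
  have hstep : ∀ n, ∫⁻ ω, expNeg (∑' i, f n (X i ω)) ∂P =
      expNeg (ENNReal.ofReal lam * ∫⁻ x, (1 - expNeg (f n x))) := by
    intro n
    refine h.lintegral_expNeg_simpleFunc hlam (f n) (fun x => ?_) ?_
    · rw [hfx]
      exact ((Set.indicator_le_self _ _ x).trans_lt (SimpleFunc.eapprox_lt_top g n x)).ne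
    · refine ne_top_of_le_ne_top (measure_ball_lt_top (x := (0 : Plane)) (r := n)).ne
        (measure_mono fun x hx => ?_)
      rw [Function.mem_support, hfx] at hx
      exact Set.mem_of_indicator_ne_zero hx
  have hL : Tendsto (fun n => ∫⁻ ω, expNeg (∑' i, f n (X i ω)) ∂P) atTop
      (𝓝 (∫⁻ ω, expNeg (∑' i, g (X i ω)) ∂P)) := by
    refine tendsto_lintegral_of_dominated_convergence (fun _ => 1) (fun n => ?_)
      (fun n => .of_forall fun ω => expNeg_le_one _) (by simp)
      (.of_forall fun ω => (continuous_expNeg.tendsto _).comp ?_)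
    · exact measurable_expNeg.comp
        (Measurable.tsum fun i => (f n).measurable.comp (h.measurable i))
    -- The sum over the points is an integral against counting measure, so monotone convergence
    -- applies to it.
    · simp_rw [← lintegral_count]
      exact lintegral_tendsto_of_tendsto_of_monotone (fun n => (measurable_of_countable _).aemeasurable)
        (.of_forall fun i => hmono _) (.of_forall fun i => hlim _)
  have hR : Tendsto (fun n => ∫⁻ x, (1 - expNeg (f n x))) atTop
      (𝓝 (∫⁻ x, (1 - expNeg (g x)))) := by
    refine lintegral_tendsto_of_tendsto_of_monotone
      (fun n => (measurable_const.sub (measurable_expNeg.comp (f n).measurable)).aemeasurable)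
      (.of_forall fun x m n hmn => tsub_le_tsub_left (expNeg_antitone (hmono x hmn)) _)
      (.of_forall fun x => ?_)
    exact ENNReal.Tendsto.sub tendsto_const_nhds ((continuous_expNeg.tendsto _).comp (hlim x))
      (Or.inl ENNReal.one_ne_top)
  refine tendsto_nhds_unique hL ?_
  simp_rw [hstep]
  exact (continuous_expNeg.tendsto _).comp
    (ENNReal.Tendsto.const_mul hR (Or.inr ENNReal.ofReal_ne_top))

end LaplaceFunctional

/-! ### Independent marking -/

section Marking

variable {Ω E : Type*} [MeasurableSpace Ω] [MeasurableSpace E]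

/-- Integrating out independent marks in a finite product. -/
theorem lintegral_prod_marked {P : Measure Ω} [IsProbabilityMeasure P] {X : ℕ → Ω → Plane}
    {M : ℕ → Ω → E} {ν : Measure E} (hX : ∀ i, Measurable (X i)) (hM : ∀ i, Measurable (M i))
    (hlaw : ∀ i, HasLaw (M i) ν P) (hind : iIndepFun M P)
    (hXM : IndepFun (fun ω i => X i ω) (fun ω i => M i ω) P)
    {F : Plane × E → ℝ≥0∞} (hF : Measurable F) (N : ℕ) :
    ∫⁻ ω, ∏ i ∈ Finset.range N, F (X i ω, M i ω) ∂P =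
      ∫⁻ ω, ∏ i ∈ Finset.range N, ∫⁻ m, F (X i ω, m) ∂ν ∂P := by
  have hXm : Measurable fun ω i => X i ω := measurable_pi_lambda _ hX
  have hMm : Measurable fun ω i => M i ω := measurable_pi_lambda _ hM
  have hK : Measurable fun p : (ℕ → Plane) × (ℕ → E) =>
      ∏ i ∈ Finset.range N, F (p.1 i, p.2 i) := by
    fun_prop
  have hprod := (indepFun_iff_map_prod_eq_prod_map_map hXm.aemeasurable hMm.aemeasurable).1 hXM
  have : IsProbabilityMeasure (P.map fun ω i => M i ω) :=
    Measure.isProbabilityMeasure_map hMm.aemeasurable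
  have : IsProbabilityMeasure ν := (hlaw 0).isProbabilityMeasure_iff.1 inferInstance
  have hφ : Measurable fun x => ∫⁻ m, F (x, m) ∂ν := hF.lintegral_prod_right'
  calc ∫⁻ ω, ∏ i ∈ Finset.range N, F (X i ω, M i ω) ∂P
      = ∫⁻ p, ∏ i ∈ Finset.range N, F (p.1 i, p.2 i)
          ∂(P.map fun ω => ((fun i => X i ω), fun i => M i ω)) := by
        rw [lintegral_map hK (hXm.prodMk hMm)]
    _ = ∫⁻ x, ∫⁻ m, ∏ i ∈ Finset.range N, F (x i, m i)
          ∂(P.map fun ω i => M i ω) ∂(P.map fun ω i => X i ω) := by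
        rw [hprod, lintegral_prod _ hK.aemeasurable]
    _ = ∫⁻ x, ∏ i ∈ Finset.range N, ∫⁻ m, F (x i, m) ∂ν ∂(P.map fun ω i => X i ω) := by
        refine lintegral_congr fun x => ?_
        rw [lintegral_map (by fun_prop) hMm]
        rw [lintegral_prod_eq_prod_lintegral_of_indepFun (Finset.range N)
          (fun i ω => F (x i, M i ω)) (hind.comp (fun i m => F (x i, m)) fun i => by fun_prop)
          fun i => hF.comp (measurable_const.prodMk (hM i))]
        exact Finset.prod_congr rfl fun i _ =>
          (hlaw i).lintegral_comp (f := fun m => F (x i, m)) (by fun_prop)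
    _ = _ := by
        exact lintegral_map
          (Finset.measurable_prod _ fun i _ => hφ.comp (measurable_pi_apply i)) hXm

/-- The Laplace transform of a shot noise of an independently marked Poisson process. -/
theorem IsHomogeneousPPP.lintegral_expNeg_tsum_marked {lam : ℝ} {P : Measure Ω}
    [IsProbabilityMeasure P] {X : ℕ → Ω → Plane} (h : IsHomogeneousPPP lam X P) (hlam : 0 ≤ lam)
    {M : ℕ → Ω → E} {ν : Measure E} (hM : ∀ i, Measurable (M i))
    (hlaw : ∀ i, HasLaw (M i) ν P) (hind : iIndepFun M P)
    (hXM : IndepFun (fun ω i => X i ω) (fun ω i => M i ω) P)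
    {ψ : Plane × E → ℝ≥0∞} (hψ : Measurable ψ) :
    ∫⁻ ω, expNeg (∑' i, ψ (X i ω, M i ω)) ∂P =
      expNeg (ENNReal.ofReal lam * ∫⁻ x, ∫⁻ m, (1 - expNeg (ψ (x, m))) ∂ν) := by
  have : IsProbabilityMeasure ν := (hlaw 0).isProbabilityMeasure_iff.1 inferInstance
  let Φ : Plane → ℝ≥0∞ := fun x => ∫⁻ m, expNeg (ψ (x, m)) ∂ν
  have hF : Measurable fun p => expNeg (ψ p) := measurable_expNeg.comp hψ
  have hφ : Measurable Φ := hF.lintegral_prod_right'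
  have hφ1 : ∀ x, Φ x ≤ 1 := fun x =>
    (lintegral_mono fun m => expNeg_le_one _).trans (by simp)
  -- Averaging over the marks replaces each factor `expNeg (ψ (x, m))` by `Φ x`, a number in `[0,
  -- 1]`. Writing it as `expNeg (g x)` reduces the marked process to the unmarked functional at `g`;
  -- where `Φ x = 0` the value `g x = ⊤` is allowed.
  let g : Plane → ℝ≥0∞ := fun x => (-(ENNReal.log (Φ x))).toENNReal
  have hg : Measurable g :=
    EReal.continuous_toENNReal.measurable.comp (ENNReal.measurable_log.comp hφ).neg
  have hgφ : ∀ x, expNeg (g x) = Φ x := fun x => expNeg_neg_log (hφ1 x)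
  have hlim : ∀ {Y : ℕ → Ω → ℝ≥0∞}, (∀ i, Measurable (Y i)) →
      Tendsto (fun N => ∫⁻ ω, ∏ i ∈ Finset.range N, expNeg (Y i ω) ∂P) atTop
        (𝓝 (∫⁻ ω, expNeg (∑' i, Y i ω) ∂P)) := by
    intro Y hY
    simp_rw [← expNeg_sum]
    refine tendsto_lintegral_of_dominated_convergence (fun _ => 1) (fun N => by fun_prop)
      (fun n => .of_forall fun ω => expNeg_le_one _) (by simp)
      (.of_forall fun ω => (continuous_expNeg.tendsto _).comp
        (ENNReal.tendsto_nat_tsum fun i => Y i ω))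
  have h1 := hlim fun i => hψ.comp ((h.measurable i).prodMk (hM i))
  have h2 := hlim fun i => hg.comp (h.measurable i)
  simp only [Function.comp_apply, hgφ] at h1 h2
  -- The marks are integrated out for finitely many points; infinite sums are reached only through
  -- the limits `h1` and `h2`, which now run along the same sequence.
  simp_rw [lintegral_prod_marked h.measurable hM hlaw hind hXM hF] at h1
  rw [tendsto_nhds_unique h1 h2, h.lintegral_expNeg_tsum hlam hg]
  simp_rw [hgφ]
  congr 3 with x
  rw [lintegral_sub (by fun_prop) (ne_top_of_le_ne_top ENNReal.one_ne_top (hφ1 x))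
    (.of_forall fun m => expNeg_le_one _)]
  simp [Φ]

end Marking

/-! ### The plane integral of the path loss -/

section PathLoss

theorem lintegral_rpow_mul_exp_neg_mul {a b : ℝ} (ha : 0 < a) (hb : 0 < b) :
    ∫⁻ t in Set.Ioi (0 : ℝ), ENNReal.ofReal (t ^ (a - 1) * Real.exp (-(b * t))) =
      ENNReal.ofReal ((1 / b) ^ a * Real.Gamma a) := by
  rw [← Real.integral_rpow_mul_exp_neg_mul_Ioi ha hb, ofReal_integral_eq_lintegral_ofReal]
  · have := integrableOn_rpow_mul_exp_neg_mul_rpow (s := a - 1) (p := 1) (by linarith) one_pos hb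
    simpa [IntegrableOn] using this
  · filter_upwards [ae_restrict_mem measurableSet_Ioi] with t ht
    have : (0 : ℝ) < t := ht
    simp only [Pi.zero_apply]
    positivity

/-- Layer-cake form of `∫₀ᵘ e^(-t) dt`: with `u` moved into an indicator, the range of `t` no longer
depends on `u`, and Tonelli can exchange `t` with a point of the plane. -/
theorem lintegral_Ioi_exp_neg_indicator {u : ℝ} (hu : 0 ≤ u) :
    ∫⁻ t in Set.Ioi (0 : ℝ), (Set.Iio u).indicator (fun t => ENNReal.ofReal (Real.exp (-t))) t =
      1 - expNeg (ENNReal.ofReal u) := by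
  rw [expNeg_ofReal hu, ← ENNReal.ofReal_one, ← ENNReal.ofReal_sub _ (by positivity),
    lintegral_indicator measurableSet_Iio, Measure.restrict_restrict measurableSet_Iio,
    Set.inter_comm, Set.Ioi_inter_Iio, ← ofReal_integral_eq_lintegral_ofReal]
  · rw [← integral_Ioc_eq_integral_Ioo, ← intervalIntegral.integral_of_le hu]
    simp
  · exact (Continuous.integrableOn_Icc (by fun_prop)).mono_set Set.Ioo_subset_Icc_self
  · exact .of_forall fun t => by positivity

/-- The set is the disc of radius `(a/t)^(1/τ)` without its centre: `Real.rpow` gives `0 ^ (-τ) =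
0`, so the origin fails the inequality. A point has no area. -/
theorem volume_pathLoss_gt {a t τ : ℝ} (ha : 0 < a) (ht : 0 < t) (hτ : 0 < τ) :
    volume {x : Plane | t < a * ‖x‖ ^ (-τ)} =
      ENNReal.ofReal (Real.pi * a ^ (2 / τ) * t ^ (-(2 / τ))) := by
  have hset : {x : Plane | t < a * ‖x‖ ^ (-τ)} =
      Metric.ball (0 : Plane) ((a / t) ^ (1 / τ)) \ {0} := by
    ext x
    simp only [Set.mem_ofPred_eq, Set.mem_sdiff, mem_ball_zero_iff, Set.mem_singleton_iff]
    rcases eq_or_ne x 0 with rfl | hx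
    · simp [Real.zero_rpow (neg_ne_zero.2 hτ.ne'), ht.le]
    · have hx' : 0 < ‖x‖ := norm_pos_iff.2 hx
      rw [Real.rpow_neg hx'.le, ← div_eq_mul_inv, lt_div_iff₀ (by positivity),
        one_div, Real.lt_rpow_inv_iff_of_pos hx'.le (by positivity) hτ, lt_div_iff₀ ht, mul_comm]
      simp [hx]
  rw [hset, measure_sdiff_null (measure_singleton _), EuclideanSpace.volume_ball_fin_two,
    ← ENNReal.ofReal_pow (by positivity), ← ENNReal.ofReal_mul (by positivity)]
  congr 1
  rw [← Real.rpow_natCast, ← Real.rpow_mul (by positivity), Real.div_rpow ha.le ht.le,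
    Real.rpow_neg ht.le, show 1 / τ * ((2 : ℕ) : ℝ) = 2 / τ by push_cast; ring]
  ring

/-- The plane integral behind the Laplace transform of power-law shot noise. -/
theorem lintegral_one_sub_expNeg_pathLoss {a τ : ℝ} (ha : 0 ≤ a) (hτ : 2 < τ) :
    ∫⁻ x : Plane, (1 - expNeg (ENNReal.ofReal (a * ‖x‖ ^ (-τ)))) =
      ENNReal.ofReal (Real.pi * Real.Gamma (1 - 2 / τ) * a ^ (2 / τ)) := by
  have hτ0 : 0 < τ := by linarith
  rcases ha.eq_or_lt with rfl | ha
  · simp [expNeg_zero, Real.zero_rpow (div_pos two_pos hτ0).ne']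
  -- Here `τ > 2` is essential: after Tonelli the integrand is `t^(-2/τ) e^(-t)`, integrable at `0`
  -- only if `2/τ < 1`. Small `t` corresponds to distant points.
  have hδ : 0 < 1 - 2 / τ := by
    rw [sub_pos, div_lt_one hτ0]; exact hτ
  have hu : Measurable fun x : Plane => a * ‖x‖ ^ (-τ) := by fun_prop
  have hmeas : Measurable (Function.uncurry fun (x : Plane) (t : ℝ) =>
      (Set.Iio (a * ‖x‖ ^ (-τ))).indicator (fun t => ENNReal.ofReal (Real.exp (-t))) t) := by
    have hS : MeasurableSet {p : Plane × ℝ | p.2 < a * ‖p.1‖ ^ (-τ)} :=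
      measurableSet_lt measurable_snd (hu.comp measurable_fst)
    have h2 : Measurable fun p : Plane × ℝ => ENNReal.ofReal (Real.exp (-p.2)) := by fun_prop
    exact h2.indicator hS
  simp_rw [← lintegral_Ioi_exp_neg_indicator (mul_nonneg ha.le (Real.rpow_nonneg (norm_nonneg _) _))]
  rw [lintegral_lintegral_swap hmeas.aemeasurable]
  have hstep : ∀ t ∈ Set.Ioi (0 : ℝ), ∫⁻ x : Plane,
      (Set.Iio (a * ‖x‖ ^ (-τ))).indicator (fun t => ENNReal.ofReal (Real.exp (-t))) t =
        ENNReal.ofReal (Real.pi * a ^ (2 / τ)) *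
          ENNReal.ofReal (t ^ (1 - 2 / τ - 1) * Real.exp (-(1 * t))) := by
    intro t ht
    have ht' : (0 : ℝ) < t := ht
    have hS : MeasurableSet {x : Plane | t < a * ‖x‖ ^ (-τ)} := measurableSet_lt measurable_const hu
    calc _ = ∫⁻ x : Plane, {x : Plane | t < a * ‖x‖ ^ (-τ)}.indicator
          (fun _ => ENNReal.ofReal (Real.exp (-t))) x := rfl
      _ = _ := by
        rw [lintegral_indicator_const hS, volume_pathLoss_gt ha ht' hτ0,
          ← ENNReal.ofReal_mul (by positivity), ← ENNReal.ofReal_mul (by positivity)]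
        congr 1
        rw [show 1 - 2 / τ - 1 = -(2 / τ) by ring, one_mul]
        ring
  rw [setLIntegral_congr_fun measurableSet_Ioi hstep, lintegral_const_mul _ (by fun_prop),
    lintegral_rpow_mul_exp_neg_mul hδ one_pos, ← ENNReal.ofReal_mul (by positivity)]
  congr 1
  simp
  ring

end PathLoss

/-! ### Gamma quotients and hypergeometric series -/

section SpecialFunctions

theorem Gamma_add_natCast {a : ℝ} (ha : 0 < a) (n : ℕ) :
    Real.Gamma (a + n) = Real.Gamma a * (ascPochhammer ℝ n).eval a := by
  induction n with
  | zero => simp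
  | succ n ih =>
    rw [ascPochhammer_succ_eval, Nat.cast_succ, ← add_assoc,
      Real.Gamma_add_one (by positivity), ih]
    ring

/-- Each step of the induction uses the functional equation twice, and `(2a+2n)(2a+2n+1) = 4
(a+n)(a+1/2+n)` splits into one new factor for each Pochhammer symbol. This is the source of the two
upper parameters, half a unit apart, in the `η-μ` constant. -/
theorem Gamma_two_mul_add_two_mul {a : ℝ} (ha : 0 < a) (n : ℕ) :
    Real.Gamma (2 * a + 2 * n) = Real.Gamma (2 * a) *
      (4 ^ n * (ascPochhammer ℝ n).eval a * (ascPochhammer ℝ n).eval (a + 1 / 2)) := by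
  induction n with
  | zero => simp
  | succ n ih =>
    rw [ascPochhammer_succ_eval, ascPochhammer_succ_eval, Nat.cast_succ,
      show 2 * a + 2 * ((n : ℝ) + 1) = 2 * a + 2 * n + 1 + 1 by ring,
      Real.Gamma_add_one (by positivity), Real.Gamma_add_one (by positivity), ih]
    ring

/-- The ratio enters as a recurrence, so terms that vanish, as for `x = 0`, need no separate
treatment. -/
theorem summable_of_tendsto_ratio_zero {t r : ℕ → ℝ} (h : ∀ n, t (n + 1) = t n * r n)
    (hr : Tendsto r atTop (𝓝 0)) : Summable t := by
  refine summable_of_ratio_norm_eventually_le (r := 1 / 2) (by norm_num) ?_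
  have h0 : Tendsto (fun n => ‖r n‖) atTop (𝓝 0) := by simpa using hr.norm
  filter_upwards [h0.eventually_le_const (show (0 : ℝ) < 1 / 2 by norm_num)] with n hn
  rw [h, norm_mul, mul_comm]
  exact mul_le_mul_of_nonneg_right hn (norm_nonneg _)

theorem tendsto_inv_add_natCast (b : ℝ) : Tendsto (fun n : ℕ => (b + n)⁻¹) atTop (𝓝 0) :=
  tendsto_inv_atTop_zero.comp (tendsto_atTop_add_const_left _ _ tendsto_natCast_atTop_atTop)

theorem hasSum_kummer (a : ℝ) {b : ℝ} (hb : 0 < b) (x : ℝ) :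
    HasSum (fun n : ℕ => (ascPochhammer ℝ n).eval a / (ascPochhammer ℝ n).eval b * x ^ n / n !)
      (kummer a b x) := by
  refine (summable_of_tendsto_ratio_zero
    (r := fun n : ℕ => (1 + (a - b) * (b + n)⁻¹) * (x * (1 + (n : ℝ))⁻¹)) (fun n => ?_) ?_).hasSum
  · have h1 : b + n ≠ 0 := by positivity
    have h2 : (ascPochhammer ℝ n).eval b ≠ 0 := (ascPochhammer_pos n b hb).ne'
    have h3 : (1 : ℝ) + n ≠ 0 := by positivity
    have h4 : ((n ! : ℕ) : ℝ) ≠ 0 := by positivity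
    rw [ascPochhammer_succ_eval, ascPochhammer_succ_eval, Nat.factorial_succ, pow_succ,
      Nat.cast_mul, Nat.cast_succ, add_comm (n : ℝ) 1]
    field_simp
    ring
  · have := (((tendsto_inv_add_natCast b).const_mul (a - b)).const_add 1).mul
      ((tendsto_inv_add_natCast 1).const_mul x)
    simpa using this

theorem hasSum_besselIFactor {ν : ℝ} (hν : 0 < ν + 1) (x : ℝ) :
    HasSum (fun n : ℕ => (x ^ 2 / 4) ^ n / ((n ! : ℝ) * Real.Gamma (ν + n + 1)))
      (besselIFactor ν x) := by
  refine (summable_of_tendsto_ratio_zero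
    (r := fun n : ℕ => (ν + 1 + n)⁻¹ * (x ^ 2 / 4 * (1 + (n : ℝ))⁻¹)) (fun n => ?_) ?_).hasSum
  · have h1 : ν + 1 + n ≠ 0 := by positivity
    have h3 : (1 : ℝ) + n ≠ 0 := by positivity
    have h4 : ((n ! : ℕ) : ℝ) ≠ 0 := by positivity
    have h5 : Real.Gamma (ν + 1 + n) ≠ 0 := (Real.Gamma_pos_of_pos (by positivity)).ne'
    rw [Nat.factorial_succ, pow_succ, Nat.cast_mul, Nat.cast_succ, add_comm (n : ℝ) 1,
      show ν + (1 + (n : ℝ)) + 1 = ν + 1 + n + 1 by ring, Real.Gamma_add_one h1,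
      show ν + (n : ℝ) + 1 = ν + 1 + n by ring]
    field_simp
  · have := (tendsto_inv_add_natCast (ν + 1)).mul
      ((tendsto_inv_add_natCast 1).const_mul (x ^ 2 / 4))
    simpa using this

theorem hasSum_ordinaryHypergeometric {a b c z : ℝ} (ha : 0 < a) (hb : 0 < b) (hc : 0 < c)
    (hz : |z| < 1) :
    HasSum (fun n : ℕ => (ascPochhammer ℝ n).eval a * (ascPochhammer ℝ n).eval b /
      (ascPochhammer ℝ n).eval c * z ^ n / n !) (ordinaryHypergeometric a b c z) := by
  -- Positive parameters are never nonpositive integers, so the series neither terminates nor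
  -- degenerates and its radius is exactly `1`.
  have hne : ∀ {d : ℝ}, 0 < d → ∀ k : ℕ, (k : ℝ) ≠ -d := fun hd k => by
    have : (0 : ℝ) ≤ k := by positivity
    linarith
  have hr := ordinaryHypergeometricSeries_radius_eq_one ℝ a b c
    fun k => ⟨hne ha k, hne hb k, hne hc k⟩
  have h := (ordinaryHypergeometricSeries ℝ a b c).hasFPowerSeriesOnBall (by rw [hr]; simp)
  rw [hr] at h
  have hs := h.hasSum (y := z) (by
    rw [mem_eball_zero_iff, ← ofReal_norm, Real.norm_eq_abs]
    exact ENNReal.ofReal_lt_one.2 hz)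
  rw [zero_add, ordinaryHypergeometricSeries_apply_eq'] at hs
  refine hs.congr_fun ?_
  intro n
  simp only [smul_eq_mul]
  field_simp

/-- The binomial series. For the first moment of `η-μ` fading the second upper parameter equals the
lower one, and `₂F₁` takes this form. -/
theorem ordinaryHypergeometric_cancel (a : ℝ) {b z : ℝ} (hb : 0 < b) (hz : |z| < 1) :
    ordinaryHypergeometric a b b z = (1 - z) ^ (-a) := by
  have hne : ∀ k : ℕ, (k : ℝ) ≠ -b := fun k => by
    have : (0 : ℝ) ≤ k := by positivity
    linarith
  have h := Real.one_add_rpow_hasFPowerSeriesOnBall_zero (a := -a)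
  rw [binomialSeries_eq_ordinaryHypergeometricSeries hne, neg_neg] at h
  have hs := h.hasSum (y := -z) (by
    rw [mem_eball_zero_iff, ← ofReal_norm, norm_neg, Real.norm_eq_abs]
    exact ENNReal.ofReal_lt_one.2 hz)
  rw [zero_add, ← sub_eq_add_neg] at hs
  rw [← hs.tsum_eq, ordinaryHypergeometric]
  refine tsum_congr fun n => ?_
  rw [FormalMultilinearSeries.compContinuousLinearMap_apply]
  congr 1
  ext i
  simp

/-- Since `(b+1)ₙ / (b)ₙ = 1 + n/b`, the series is the exponential series plus `1/b` times its Euler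
derivative. It gives the mean of `κ-μ` fading. -/
theorem kummer_add_one {b : ℝ} (hb : 0 < b) (x : ℝ) :
    kummer (b + 1) b x = Real.exp x * (1 + x / b) := by
  have hexp : HasSum (fun n : ℕ => x ^ n / n !) (Real.exp x) := by
    have := NormedSpace.expSeries_div_hasSum_exp x
    rwa [← Real.exp_eq_exp_ℝ] at this
  have h2 : HasSum (fun n : ℕ => n * (x ^ n / n !)) (x * Real.exp x) := by
    rw [← hasSum_nat_add_iff' 1]
    simp only [Finset.range_one, Finset.sum_singleton, Nat.cast_zero, zero_mul, sub_zero]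
    refine (hexp.mul_left x).congr_fun fun n => ?_
    have : (n : ℝ) + 1 ≠ 0 := by positivity
    rw [Nat.factorial_succ, Nat.cast_mul, Nat.cast_succ, pow_succ]
    field_simp
  have h3 := hexp.add (h2.mul_left b⁻¹)
  rw [(hasSum_kummer (b + 1) hb x).unique (h3.congr_fun fun n => ?_)]
  · field_simp
  · have hG : (0 : ℝ) < Real.Gamma b := Real.Gamma_pos_of_pos hb
    have hP : 0 < (ascPochhammer ℝ n).eval b := ascPochhammer_pos n b hb
    have h1 : Real.Gamma (b + 1) * (ascPochhammer ℝ n).eval (b + 1) =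
        (b + n) * (Real.Gamma b * (ascPochhammer ℝ n).eval b) := by
      rw [← Gamma_add_natCast (by positivity), ← Gamma_add_natCast hb,
        ← Real.Gamma_add_one (by positivity)]
      congr 1
      ring
    rw [Real.Gamma_add_one hb.ne'] at h1
    have h4 : (ascPochhammer ℝ n).eval (b + 1) = (b + n) / b * (ascPochhammer ℝ n).eval b := by
      field_simp
      have := mul_left_cancel₀ hG.ne' (show Real.Gamma b * (b * (ascPochhammer ℝ n).eval (b + 1)) =
        Real.Gamma b * ((b + n) * (ascPochhammer ℝ n).eval b) by linarith)
      linarith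
    rw [h4]
    field_simp

/-- By reflection, `1 / (Γ(δ+1) sinc δ) = π / (Γ(δ) sin πδ) = Γ(1-δ)`. The right-hand side is what
the plane integral and a gamma moment produce. -/
theorem realBinom_mul_inv_nsinc {m δ : ℝ} (hδ : 0 < δ) (hδ1 : δ < 1) :
    realBinom (m + δ - 1) δ / nsinc δ =
      Real.Gamma (1 - δ) * (Real.Gamma (m + δ) / Real.Gamma m) := by
  have hpos : 0 < Real.pi * δ := mul_pos Real.pi_pos hδ
  have hsin : 0 < Real.sin (Real.pi * δ) := Real.sin_pos_of_pos_of_lt_pi hpos (by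
    nlinarith [Real.pi_pos])
  have hG : Real.Gamma δ ≠ 0 := (Real.Gamma_pos_of_pos hδ).ne'
  have h := Real.Gamma_mul_Gamma_one_sub δ
  rw [realBinom, nsinc, Real.sinc_of_ne_zero hpos.ne', Real.Gamma_add_one hδ.ne',
    show m + δ - 1 + 1 = m + δ by ring, show m + δ - 1 - δ + 1 = m by ring]
  have h' : Real.Gamma (1 - δ) = Real.pi / Real.sin (Real.pi * δ) / Real.Gamma δ := by
    rw [← h]; field_simp
  rw [h']
  field_simp

end SpecialFunctions

/-! ### Fading laws as gamma mixtures, and their moments -/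

section Moments

/-- The moments of a mixture of gamma laws with a common rate. -/
theorem lintegral_rpow_gammaMixture {f : ℝ → ℝ} {wt a : ℕ → ℝ} {b p m : ℝ} (hb : 0 < b)
    (ha : ∀ n, 0 < a n) (hwt : ∀ n, 0 ≤ wt n) (hp : 0 ≤ p)
    (hf : ∀ x, 0 < x → HasSum (fun n => wt n *
      (b ^ a n / Real.Gamma (a n) * (x ^ (a n - 1) * Real.exp (-(b * x))))) (f x))
    (hm : HasSum (fun n => wt n * (Real.Gamma (a n + p) / Real.Gamma (a n))) m) :
    ∫⁻ x, ENNReal.ofReal (x ^ p) ∂(lawOfDensity f) = ENNReal.ofReal ((1 / b) ^ p * m) := by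
  have hΓ : ∀ n, 0 < Real.Gamma (a n) := fun n => Real.Gamma_pos_of_pos (ha n)
  let k : ℕ → ℝ := fun n => wt n * (b ^ a n / Real.Gamma (a n))
  have hk : ∀ n, 0 ≤ k n := fun n =>
    mul_nonneg (hwt n) (div_nonneg (by positivity) (hΓ n).le)
  let F : ℕ → ℝ → ℝ≥0∞ := fun n x =>
    ENNReal.ofReal (k n * (x ^ (a n - 1) * Real.exp (-(b * x))))
  have hF : ∀ n, Measurable (F n) := fun n => by fun_prop
  -- With the density replaced by its series, measurability comes from the terms, so none is
  -- required of `f`, and sum and integral can be exchanged by nonnegativity.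
  have hlaw : lawOfDensity f =
      (volume.restrict (Set.Ioi 0)).withDensity fun x => ∑' n, F n x := by
    refine withDensity_congr_ae ?_
    filter_upwards [ae_restrict_mem measurableSet_Ioi] with x hx
    have hx' : (0 : ℝ) < x := hx
    have h := hf x hx'
    simp_rw [← mul_assoc (wt _), F] at h ⊢
    rw [← h.tsum_eq, ENNReal.ofReal_tsum_of_nonneg _ h.summable]
    exact fun n => mul_nonneg (hk n) (by positivity)
  have hterm : ∀ n, ∫⁻ x in Set.Ioi (0 : ℝ), F n x * ENNReal.ofReal (x ^ p) =
      ENNReal.ofReal ((1 / b) ^ p * (wt n * (Real.Gamma (a n + p) / Real.Gamma (a n)))) := by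
    intro n
    have hap : 0 < a n + p := by linarith [ha n]
    have h1 : ∀ x ∈ Set.Ioi (0 : ℝ), F n x * ENNReal.ofReal (x ^ p) =
        ENNReal.ofReal (k n) * ENNReal.ofReal (x ^ (a n + p - 1) * Real.exp (-(b * x))) := by
      intro x hx
      have hx' : (0 : ℝ) < x := hx
      rw [← ENNReal.ofReal_mul (mul_nonneg (hk n) (by positivity)), ← ENNReal.ofReal_mul (hk n),
        show a n + p - 1 = a n - 1 + p by ring, Real.rpow_add hx']
      congr 1
      ring
    rw [setLIntegral_congr_fun measurableSet_Ioi h1, lintegral_const_mul _ (by fun_prop),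
      lintegral_rpow_mul_exp_neg_mul hap hb, ← ENNReal.ofReal_mul (hk n)]
    congr 1
    have hb1 : b ^ a n * (1 / b) ^ a n = 1 := by
      rw [← Real.mul_rpow hb.le (by positivity), mul_one_div_cancel hb.ne', Real.one_rpow]
    rw [Real.rpow_add (by positivity)]
    simp only [k]
    calc _ = (b ^ a n * (1 / b) ^ a n) *
          ((1 / b) ^ p * (wt n * (Real.Gamma (a n + p) / Real.Gamma (a n)))) := by ring
      _ = _ := by rw [hb1, one_mul]
  rw [hlaw, lintegral_withDensity_eq_lintegral_mul _ (Measurable.tsum hF)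
    (by fun_prop)]
  simp only [Pi.mul_apply, ← ENNReal.tsum_mul_right]
  have hFp : ∀ n, AEMeasurable (fun x => F n x * ENNReal.ofReal (x ^ p))
      (volume.restrict (Set.Ioi 0)) := fun n => ((hF n).mul (by fun_prop)).aemeasurable
  rw [lintegral_tsum hFp]
  simp_rw [hterm]
  rw [← ENNReal.ofReal_tsum_of_nonneg _ (hm.mul_left _).summable, (hm.mul_left _).tsum_eq]
  intro n
  have := (Real.Gamma_pos_of_pos (show 0 < a n + p by linarith [ha n])).le
  exact mul_nonneg (by positivity) (mul_nonneg (hwt n) (div_nonneg this (hΓ n).le))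

/-- Expanding the Bessel factor shows a Poisson mixture: the shape is `μ + N` with `N` Poisson of
mean `μκ`, and the rate is `μ(1+κ)/w`. -/
theorem hasSum_kappaMuPDF {κ μ w x : ℝ} (hκ : 0 < κ) (hμ : 0 < μ) (hw : 0 < w) (hx : 0 < x) :
    HasSum (fun n : ℕ => Real.exp (-(μ * κ)) * ((μ * κ) ^ n / n !) *
      ((μ * (1 + κ) / w) ^ (μ + n) / Real.Gamma (μ + n) *
        (x ^ (μ + n - 1) * Real.exp (-(μ * (1 + κ) / w * x))))) (kappaMuPDF κ μ w x) := by
  have hA : 0 < (1 + κ) / w := by positivity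
  set A := (1 + κ) / w with hAdef
  have h := (hasSum_besselIFactor (ν := μ - 1) (by linarith)
    (2 * μ * √(κ * (1 + κ) / w * x))).mul_left
      (μ / (κ ^ ((μ - 1) / 2) * Real.exp (μ * κ)) * A ^ ((μ + 1) / 2)
      * x ^ ((μ - 1) / 2) * Real.exp (-(μ * (1 + κ) / w * x)) *
        (2 * μ * √(κ * (1 + κ) / w * x) / 2) ^ (μ - 1))
  rw [kappaMuPDF, besselI, ← mul_assoc]
  refine h.congr_fun fun n => ?_
  have e1 : κ * (1 + κ) / w * x = κ * (A * x) := by rw [hAdef]; ring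
  have e2 : μ * (1 + κ) / w = μ * A := by rw [hAdef]; ring
  have e3 : (2 * μ * √(κ * (A * x)) / 2) ^ (μ - 1) =
      μ ^ (μ - 1) * (κ ^ ((μ - 1) / 2) * (A ^ ((μ - 1) / 2) * x ^ ((μ - 1) / 2))) := by
    rw [show 2 * μ * √(κ * (A * x)) / 2 = μ * √(κ * (A * x)) by ring,
      Real.mul_rpow hμ.le (Real.sqrt_nonneg _), Real.sqrt_eq_rpow,
      ← Real.rpow_mul (by positivity), Real.mul_rpow hκ.le (by positivity),
      Real.mul_rpow hA.le hx.le, show 1 / 2 * (μ - 1) = (μ - 1) / 2 by ring]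
  have e4 : (2 * μ * √(κ * (A * x))) ^ 2 / 4 = μ ^ 2 * (κ * (A * x)) := by
    rw [mul_pow, Real.sq_sqrt (by positivity)]; ring
  have e5 : A ^ ((μ + 1) / 2) * A ^ ((μ - 1) / 2) = A ^ μ := by
    rw [← Real.rpow_add hA]; congr 1; ring
  have e6 : x ^ ((μ - 1) / 2) * x ^ ((μ - 1) / 2) = x ^ (μ - 1) := by
    rw [← Real.rpow_add hx]; congr 1; ring
  have e7 : μ * μ ^ (μ - 1) = μ ^ μ := by
    rw [mul_comm, ← Real.rpow_add_one hμ.ne']; congr 1; ring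
  have e8 : x ^ (μ + n - 1) = x ^ (μ - 1) * x ^ n := by
    rw [← Real.rpow_natCast x n, ← Real.rpow_add hx]; congr 1; ring
  have e9 : (μ * A) ^ (μ + n) = μ ^ μ * A ^ μ * (μ ^ n * A ^ n) := by
    rw [Real.rpow_add (by positivity), Real.rpow_natCast, Real.mul_rpow hμ.le hA.le, mul_pow]
  have hκ' : κ ^ ((μ - 1) / 2) ≠ 0 := (Real.rpow_pos_of_pos hκ _).ne'
  rw [e1, e2, e3, e4, e8, e9, ← e5, ← e6, ← e7, Real.exp_neg (μ * κ),
    show μ - 1 + (n : ℝ) + 1 = μ + n by ring]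
  simp only [mul_pow]
  field_simp
  ring

theorem lintegral_rpow_kappaMuLaw {κ μ w p : ℝ} (hκ : 0 < κ) (hμ : 0 < μ) (hw : 0 < w)
    (hp : 0 ≤ p) :
    ∫⁻ x, ENNReal.ofReal (x ^ p) ∂(kappaMuLaw κ μ w) =
      ENNReal.ofReal ((w / ((1 + κ) * μ)) ^ p * (Real.exp (-(μ * κ)) *
        (Real.Gamma (μ + p) / Real.Gamma μ) * kummer (μ + p) μ (μ * κ))) := by
  rw [kappaMuLaw, lintegral_rpow_gammaMixture (b := μ * (1 + κ) / w) (by positivity)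
    (fun n => by positivity) (fun n => by positivity) hp
    (fun x hx => hasSum_kappaMuPDF hκ hμ hw hx)
    (((hasSum_kummer (μ + p) hμ (μ * κ)).mul_left (Real.exp (-(μ * κ)) *
        (Real.Gamma (μ + p) / Real.Gamma μ))).congr_fun fun n => ?_)]
  · rw [one_div_div, mul_comm μ]
  -- `Γ(μ+n+p) / Γ(μ+n)` is `Γ(μ+p)/Γ(μ)` times `(μ+p)ₙ/(μ)ₙ`, the Kummer coefficient.
  · have h1 : (ascPochhammer ℝ n).eval μ ≠ 0 := (ascPochhammer_pos n μ hμ).ne'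
    have h2 : Real.Gamma μ ≠ 0 := (Real.Gamma_pos_of_pos hμ).ne'
    rw [show μ + n + p = μ + p + n by ring, Gamma_add_natCast (by positivity),
      Gamma_add_natCast hμ]
    field_simp

theorem lintegral_id_kappaMuLaw {κ μ w : ℝ} (hκ : 0 < κ) (hμ : 0 < μ) (hw : 0 < w) :
    ∫⁻ x, ENNReal.ofReal x ∂(kappaMuLaw κ μ w) = ENNReal.ofReal w := by
  have h := lintegral_rpow_kappaMuLaw hκ hμ hw zero_le_one
  simp only [Real.rpow_one] at h
  rw [h, kummer_add_one hμ, Real.Gamma_add_one hμ.ne', Real.exp_neg]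
  congr 1
  have h2 : Real.Gamma μ ≠ 0 := (Real.Gamma_pos_of_pos hμ).ne'
  field_simp

theorem etaSmallH_pos {η : ℝ} (hη : 0 < η) : 0 < etaSmallH η := by
  unfold etaSmallH; positivity

theorem etaSmallH_sq_sub {η : ℝ} (hη : 0 < η) :
    etaSmallH η ^ 2 - etaBigH η ^ 2 = etaSmallH η := by
  unfold etaSmallH etaBigH
  field_simp
  ring

/-- This identity, a form of `h² - H² = h`, makes the mixture weights of `η-μ` fading sum to one,
keeps the argument of `₂F₁` inside the unit disc and fixes the mean. -/
theorem one_sub_etaRatio_sq {η : ℝ} (hη : 0 < η) :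
    1 - (etaBigH η / etaSmallH η) ^ 2 = (etaSmallH η)⁻¹ := by
  have h := (etaSmallH_pos hη).ne'
  have h2 := etaSmallH_sq_sub hη
  field_simp
  linarith

theorem abs_etaRatio_sq_lt_one {η : ℝ} (hη : 0 < η) :
    |(etaBigH η / etaSmallH η) ^ 2| < 1 := by
  rw [abs_of_nonneg (sq_nonneg _)]
  have := inv_pos.2 (etaSmallH_pos hη)
  rw [← one_sub_etaRatio_sq hη] at this
  linarith

/-- A negative binomial mixture: with `z = (H/h)²` the weights are `(1-z)^μ (μ)ₙ zⁿ / n!`, and the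
shape is `2μ + 2n`. Only `H²` enters, so the sign of `H` and the case `H = 0` play no role. -/
theorem hasSum_etaMuPDF {η μ w x : ℝ} (hη : 0 < η) (hμ : 0 < μ) (hw : 0 < w) (hx : 0 < x) :
    HasSum (fun n : ℕ => (etaSmallH η ^ μ)⁻¹ *
        ((ascPochhammer ℝ n).eval μ * ((etaBigH η / etaSmallH η) ^ 2) ^ n / n !) *
      ((2 * μ * etaSmallH η / w) ^ (2 * μ + 2 * n) / Real.Gamma (2 * μ + 2 * n) *
        (x ^ (2 * μ + 2 * n - 1) * Real.exp (-(2 * μ * etaSmallH η / w * x)))))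
      (etaMuPDF η μ w x) := by
  have hh := etaSmallH_pos hη
  set h := etaSmallH η
  set H := etaBigH η
  have hs := (hasSum_besselIFactor (ν := μ - 1 / 2) (by linarith) (2 * μ * H * x / w)).mul_left
    (2 * √Real.pi * μ ^ (μ + 1 / 2) * h ^ μ / (Real.Gamma μ * w ^ (μ + 1 / 2))
      * x ^ (μ - 1 / 2) * Real.exp (-(2 * μ * h * x / w)) * (μ * x / w) ^ (μ - 1 / 2))
  rw [etaMuPDF, ← mul_assoc]
  refine hs.congr_fun fun n => ?_
  have hy : 0 < μ / w := by positivity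
  set y := μ / w with hydef
  have hG : Real.Gamma μ ≠ 0 := (Real.Gamma_pos_of_pos hμ).ne'
  have hG2 : Real.Gamma (μ + 1 / 2) ≠ 0 := (Real.Gamma_pos_of_pos (by positivity)).ne'
  have hG3 : Real.Gamma (2 * μ) ≠ 0 := (Real.Gamma_pos_of_pos (by positivity)).ne'
  have hP1 : (ascPochhammer ℝ n).eval μ ≠ 0 := (ascPochhammer_pos n μ hμ).ne'
  have hP2 : (ascPochhammer ℝ n).eval (μ + 1 / 2) ≠ 0 :=
    (ascPochhammer_pos n _ (by positivity)).ne'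
  -- Legendre duplication trades `√π` and the half-integer shifted Gamma value of the Bessel series
  -- for the `Γ(2μ)` of the gamma densities.
  have hdup : Real.Gamma (2 * μ) * 2 * √Real.pi =
      Real.Gamma μ * Real.Gamma (μ + 1 / 2) * 2 ^ (2 * μ) := by
    rw [Real.Gamma_mul_Gamma_add_half, Real.rpow_sub two_pos, Real.rpow_one]
    have : (2 : ℝ) ^ (2 * μ) ≠ 0 := (Real.rpow_pos_of_pos two_pos _).ne'
    field_simp
  have e1 : μ ^ (μ + 1 / 2) = y ^ (μ + 1 / 2) * w ^ (μ + 1 / 2) := by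
    rw [← Real.mul_rpow hy.le hw.le, hydef, div_mul_cancel₀ _ hw.ne']
  have e2 : (μ * x / w) ^ (μ - 1 / 2) = y ^ (μ - 1 / 2) * x ^ (μ - 1 / 2) := by
    rw [← Real.mul_rpow hy.le hx.le, hydef]; congr 1; ring
  have e3 : y ^ (μ + 1 / 2) * y ^ (μ - 1 / 2) = y ^ (2 * μ) := by
    rw [← Real.rpow_add hy]; congr 1; ring
  have e4 : x ^ (μ - 1 / 2) * x ^ (μ - 1 / 2) = x ^ (2 * μ - 1) := by
    rw [← Real.rpow_add hx]; congr 1; ring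
  have e5 : x ^ (2 * μ + 2 * n - 1) = x ^ (2 * μ - 1) * x ^ (2 * n) := by
    rw [← Real.rpow_natCast x (2 * n), ← Real.rpow_add hx]; congr 1; push_cast; ring
  have e6 : (2 * μ * h / w) ^ (2 * μ + 2 * n) =
      2 ^ (2 * μ) * (h ^ μ * h ^ μ) * y ^ (2 * μ) * (2 ^ (2 * n) * h ^ (2 * n) * y ^ (2 * n)) := by
    rw [show 2 * μ * h / w = 2 * h * y by rw [hydef]; ring,
      show 2 * μ + 2 * (n : ℝ) = 2 * μ + (2 * n : ℕ) by push_cast; ring,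
      Real.rpow_add (by positivity), Real.rpow_natCast, Real.mul_rpow (by positivity) hy.le,
      Real.mul_rpow two_pos.le hh.le, mul_pow, mul_pow, ← Real.rpow_add hh, two_mul μ]
  have e7 : (2 * μ * H * x / w) ^ 2 / 4 = (y * H * x) ^ 2 := by rw [hydef]; ring
  have e8 : Real.Gamma (μ - 1 / 2 + n + 1) =
      Real.Gamma (μ + 1 / 2) * (ascPochhammer ℝ n).eval (μ + 1 / 2) := by
    rw [← Gamma_add_natCast (by positivity)]; congr 1; ring
  have hw' : w ^ (μ + 1 / 2) ≠ 0 := (Real.rpow_pos_of_pos hw _).ne'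
  have hh' : h ^ μ ≠ 0 := (Real.rpow_pos_of_pos hh _).ne'
  have hexp : 2 * μ * h / w * x = 2 * μ * h * x / w := by ring
  have e9 : 2 ^ (2 * μ) = Real.Gamma (2 * μ) * 2 * √Real.pi /
      (Real.Gamma μ * Real.Gamma (μ + 1 / 2)) := by
    rw [hdup]; field_simp
  rw [hexp, e6, e5, e7, e8, e1, e2, ← e3, ← e4, Gamma_two_mul_add_two_mul hμ, e9,
    show (4 : ℝ) ^ n = 2 ^ (2 * n) by rw [pow_mul]; norm_num]
  simp only [mul_pow, div_pow, ← pow_mul]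
  field_simp

theorem lintegral_rpow_etaMuLaw {η μ w p : ℝ} (hη : 0 < η) (hμ : 0 < μ) (hw : 0 < w)
    (hp : 0 ≤ p) :
    ∫⁻ x, ENNReal.ofReal (x ^ p) ∂(etaMuLaw η μ w) =
      ENNReal.ofReal ((w / (2 * μ * etaSmallH η)) ^ p * ((etaSmallH η ^ μ)⁻¹ *
        (Real.Gamma (2 * μ + p) / Real.Gamma (2 * μ)) *
          ordinaryHypergeometric (μ + p / 2 + 1 / 2) (μ + p / 2) (μ + 1 / 2)
            ((etaBigH η / etaSmallH η) ^ 2))) := by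
  have hh := etaSmallH_pos hη
  have hF := hasSum_ordinaryHypergeometric (a := μ + p / 2 + 1 / 2) (b := μ + p / 2)
    (c := μ + 1 / 2) (by positivity) (by positivity) (by positivity) (abs_etaRatio_sq_lt_one hη)
  rw [etaMuLaw, lintegral_rpow_gammaMixture (b := 2 * μ * etaSmallH η / w) (by positivity)
    (fun n => by positivity) (fun n => ?_) hp
    (fun x hx => hasSum_etaMuPDF hη hμ hw hx)
    ((hF.mul_left ((etaSmallH η ^ μ)⁻¹ *
        (Real.Gamma (2 * μ + p) / Real.Gamma (2 * μ)))).congr_fun fun n => ?_)]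
  · rw [one_div_div]
  · have := (ascPochhammer_pos n μ hμ).le
    positivity
  · have h1 : (ascPochhammer ℝ n).eval μ ≠ 0 := (ascPochhammer_pos n μ hμ).ne'
    have h3 : (ascPochhammer ℝ n).eval (μ + 1 / 2) ≠ 0 :=
      (ascPochhammer_pos n _ (by positivity)).ne'
    have h2 : Real.Gamma (2 * μ) ≠ 0 := (Real.Gamma_pos_of_pos (by positivity)).ne'
    -- In the quotient the powers of `4` cancel, and `(μ)ₙ` cancels against the mixture weight; the
    -- `₂F₁` coefficient remains.
    rw [show 2 * μ + 2 * (n : ℝ) + p = 2 * (μ + p / 2) + 2 * n by ring,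
      Gamma_two_mul_add_two_mul (by positivity), Gamma_two_mul_add_two_mul hμ,
      show 2 * (μ + p / 2) = 2 * μ + p by ring]
    field_simp

theorem lintegral_id_etaMuLaw {η μ w : ℝ} (hη : 0 < η) (hμ : 0 < μ) (hw : 0 < w) :
    ∫⁻ x, ENNReal.ofReal x ∂(etaMuLaw η μ w) = ENNReal.ofReal w := by
  have h := lintegral_rpow_etaMuLaw hη hμ hw zero_le_one
  have hh := etaSmallH_pos hη
  simp only [Real.rpow_one] at h
  rw [h, ordinaryHypergeometric_cancel _ (by positivity) (abs_etaRatio_sq_lt_one hη),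
    one_sub_etaRatio_sq hη, Real.Gamma_add_one (by positivity),
    Real.inv_rpow hh.le, Real.rpow_neg hh.le, inv_inv,
    show μ + 1 / 2 + 1 / 2 = μ + 1 by ring, Real.rpow_add_one hh.ne']
  congr 1
  have h2 : Real.Gamma (2 * μ) ≠ 0 := (Real.Gamma_pos_of_pos (by positivity)).ne'
  have h3 : etaSmallH η ^ μ ≠ 0 := (Real.rpow_pos_of_pos hh _).ne'
  field_simp

end Moments

/-! ### Law of the marks and the moment of the mark power -/

section MarkLaws

instance sFinite_lawOfDensity (f : ℝ → ℝ) : SFinite (lawOfDensity f) := by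
  unfold lawOfDensity; infer_instance

instance sFinite_linkLaw (ξ : ℝ) : SFinite (linkLaw ξ) := by
  unfold linkLaw; infer_instance

theorem ae_pos_lawOfDensity (f : ℝ → ℝ) : ∀ᵐ x ∂(lawOfDensity f), 0 < x :=
  (withDensity_absolutelyContinuous _ _).ae_le (ae_restrict_mem measurableSet_Ioi)

theorem lintegral_linkLaw (ξ : ℝ) {g : ℝ → ℝ≥0∞} (hg : Measurable g) :
    ∫⁻ x, g x ∂(linkLaw ξ) = ∫⁻ x in Set.Ioi 0,
      ENNReal.ofReal (2 * Real.pi * ξ * x * Real.exp (-(ξ * Real.pi * x ^ 2))) * g x := by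
  rw [linkLaw, lawOfDensity, lintegral_withDensity_eq_lintegral_mul _ (by fun_prop) hg]
  rfl

theorem isProbabilityMeasure_linkLaw {ξ : ℝ} (hξ : 0 < ξ) : IsProbabilityMeasure (linkLaw ξ) := by
  constructor
  have hb : 0 < ξ * Real.pi := by positivity
  have h := integral_rpow_mul_exp_neg_mul_rpow (p := 2) (q := 1) two_pos (by norm_num) hb
  have hi := integrableOn_rpow_mul_exp_neg_mul_rpow (p := 2) (s := 1) (by norm_num) two_pos hb
  rw [← lintegral_one, lintegral_linkLaw ξ measurable_const]
  have he : ∀ x : ℝ, ENNReal.ofReal (2 * Real.pi * ξ * x * Real.exp (-(ξ * Real.pi * x ^ 2))) * 1 =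
      ENNReal.ofReal (2 * (ξ * Real.pi)) *
        ENNReal.ofReal (x ^ (1 : ℝ) * Real.exp (-(ξ * Real.pi) * x ^ (2 : ℝ))) := by
    intro x
    rw [mul_one, ← ENNReal.ofReal_mul (by positivity), Real.rpow_one, Real.rpow_two, neg_mul]
    congr 1
    ring
  simp_rw [he]
  rw [lintegral_const_mul _ (by fun_prop), ← ofReal_integral_eq_lintegral_ofReal hi, h,
    ← ENNReal.ofReal_mul (by positivity), ← ENNReal.ofReal_one]
  · congr 1
    rw [show -((1 : ℝ) + 1) / 2 = -1 by norm_num, show ((1 : ℝ) + 1) / 2 = 1 by norm_num,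
      Real.rpow_neg_one, Real.Gamma_one]
    field_simp
  · filter_upwards [ae_restrict_mem measurableSet_Ioi] with x hx
    have hx' : (0 : ℝ) < x := hx
    simp only [Pi.zero_apply]
    positivity

theorem lowerGamma_two_nonneg {x : ℝ} (hx : 0 ≤ x) : 0 ≤ lowerGamma 2 x := by
  refine intervalIntegral.integral_nonneg hx fun t ht => ?_
  have := ht.1
  positivity

/-- Substitution `u = ξπx²`, under which the Rayleigh density becomes exponential and `x²` becomes
`u/(ξπ)`. -/
theorem intervalIntegral_linkLaw_sq {ξ : ℝ} (hξ : 0 < ξ) (θ : ℝ) :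
    ∫ x in (0 : ℝ)..θ, 2 * Real.pi * ξ * x * Real.exp (-(ξ * Real.pi * x ^ 2)) * x ^ 2 =
      lowerGamma 2 (ξ * Real.pi * θ ^ 2) / (ξ * Real.pi) := by
  have h := intervalIntegral.integral_comp_mul_deriv (a := 0) (b := θ)
    (f := fun x => ξ * Real.pi * x ^ 2) (f' := fun x => ξ * Real.pi * (2 * x))
    (g := fun u => u * Real.exp (-u))
    (fun x _ => by simpa using (hasDerivAt_pow 2 x).const_mul (ξ * Real.pi))
    (by fun_prop) (by fun_prop)
  have hl : lowerGamma 2 (ξ * Real.pi * θ ^ 2) =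
      ∫ u in (0 : ℝ)..ξ * Real.pi * θ ^ 2, u * Real.exp (-u) := by
    unfold lowerGamma
    norm_num
  rw [hl, eq_div_iff (by positivity), ← intervalIntegral.integral_mul_const]
  simp only [ne_eq, OfNat.ofNat_ne_zero, not_false_eq_true, zero_pow, mul_zero] at h
  rw [← h]
  refine intervalIntegral.integral_congr fun x _ => ?_
  simp only [Function.comp_apply]
  ring

/-- The transmit power moment of order `2 / τ` of a UE, on the event of D2D mode. -/
theorem lintegral_linkLaw_power {ξ θ τ : ℝ} (hξ : 0 < ξ) (hθ : 0 < θ) (hτ : 0 < τ) :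
    ∫⁻ x, (Set.Iic θ).indicator (fun x => ENNReal.ofReal (x ^ τ) ^ (2 / τ)) x ∂(linkLaw ξ) =
      ENNReal.ofReal (lowerGamma 2 (ξ * Real.pi * θ ^ 2) / (ξ * Real.pi)) := by
  have hm : Measurable fun x : ℝ => ENNReal.ofReal (x ^ τ) ^ (2 / τ) := by fun_prop
  rw [lintegral_linkLaw ξ (hm.indicator measurableSet_Iic), ← intervalIntegral_linkLaw_sq hξ,
    intervalIntegral.integral_of_le hθ.le, ofReal_integral_eq_lintegral_ofReal]
  · rw [← Set.Ioi_inter_Iic, Set.inter_comm, ← Measure.restrict_restrict measurableSet_Iic,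
      ← lintegral_indicator measurableSet_Iic]
    refine setLIntegral_congr_fun measurableSet_Ioi fun x hx => ?_
    have hx' : (0 : ℝ) < x := hx
    by_cases hxθ : x ∈ Set.Iic θ
    · rw [Set.indicator_of_mem hxθ, Set.indicator_of_mem hxθ,
        ENNReal.ofReal_rpow_of_nonneg (by positivity) (by positivity), ← Real.rpow_mul hx'.le,
        mul_div_cancel₀ _ hτ.ne', Real.rpow_two, ← ENNReal.ofReal_mul (by positivity)]
    · rw [Set.indicator_of_notMem hxθ, Set.indicator_of_notMem hxθ, mul_zero]
  · exact (Continuous.integrableOn_Icc (by fun_prop)).mono_set Set.Ioc_subset_Icc_self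
  · filter_upwards [ae_restrict_mem measurableSet_Ioc] with x hx
    have hx' : (0 : ℝ) < x := hx.1
    simp only [Pi.zero_apply]
    positivity

theorem lintegral_bernoulliMeasure_true (q : I) :
    ∫⁻ b, (if b = true then 1 else 0 : ℝ≥0∞) ∂(bernoulliMeasure true false q) =
      ENNReal.ofReal q := by
  rw [bernoulliMeasure_def, lintegral_add_measure, lintegral_smul_measure,
    lintegral_smul_measure, lintegral_dirac, lintegral_dirac]
  simp [ENNReal.smul_def, ENNReal.ofReal, Real.toNNReal_of_nonneg q.2.1]
  rfl

/-- The law of the mark vector `(type, link length, ALOHA indicator, fading)` of a UE. -/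
noncomputable def markLaw (q ε : I) (ξ : ℝ) (fading : Measure ℝ) : Measure (Bool × ℝ × Bool × ℝ) :=
  (bernoulliMeasure true false q).prod
    ((linkLaw ξ).prod ((bernoulliMeasure true false ε).prod fading))

/-- The transmit power times the fading coefficient of a UE with the given mark vector, zero if the
UE does not transmit in D2D mode. -/
noncomputable def markPower (θ τ : ℝ) (m : Bool × ℝ × Bool × ℝ) : ℝ≥0∞ :=
  (if m.1 = true then 1 else 0) * ((Set.Iic θ).indicator (fun x => ENNReal.ofReal (x ^ τ)) m.2.1 *
    ((if m.2.2.1 = true then 1 else 0) * ENNReal.ofReal m.2.2.2))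

theorem measurable_markPower (θ τ : ℝ) : Measurable (markPower θ τ) := by
  have h1 : Measurable fun b : Bool => (if b = true then 1 else 0 : ℝ≥0∞) := .of_discrete
  have h2 : Measurable ((Set.Iic θ).indicator fun x : ℝ => ENNReal.ofReal (x ^ τ)) :=
    Measurable.indicator (by fun_prop) measurableSet_Iic
  exact (h1.comp measurable_fst).mul ((h2.comp (measurable_fst.comp measurable_snd)).mul
    ((h1.comp (measurable_fst.comp (measurable_snd.comp measurable_snd))).mul
      (measurable_snd.comp (measurable_snd.comp measurable_snd)).ennreal_ofReal))

theorem markPower_ne_top (θ τ : ℝ) (m : Bool × ℝ × Bool × ℝ) : markPower θ τ m ≠ ⊤ := by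
  have h : ∀ b : Bool, (if b = true then 1 else 0 : ℝ≥0∞) ≠ ⊤ := by
    intro b; cases b <;> simp
  refine ENNReal.mul_ne_top (h _) (ENNReal.mul_ne_top ?_
    (ENNReal.mul_ne_top (h _) ENNReal.ofReal_ne_top))
  exact ne_top_of_le_ne_top ENNReal.ofReal_ne_top (Set.indicator_le_self _ _ _)

/-- The mark power is a product of functions of single marks and the mark law is a product measure,
so the moment factorises. Indicators are unchanged by a positive power. -/
theorem lintegral_markPower_rpow {q ε : I} {ξ θ τ M : ℝ} (hξ : 0 < ξ) (hθ : 0 < θ) (hτ : 0 < τ)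
    {f : ℝ → ℝ} (hM : ∫⁻ x, ENNReal.ofReal (x ^ (2 / τ)) ∂(lawOfDensity f) = ENNReal.ofReal M) :
    ∫⁻ m, markPower θ τ m ^ (2 / τ) ∂(markLaw q ε ξ (lawOfDensity f)) =
      ENNReal.ofReal (q * (lowerGamma 2 (ξ * Real.pi * θ ^ 2) / (ξ * Real.pi) * (ε * M))) := by
  have hδ : 0 < 2 / τ := by positivity
  have hif : ∀ b : Bool, (if b = true then 1 else 0 : ℝ≥0∞) ^ (2 / τ) =
      if b = true then 1 else 0 := by
    intro b; cases b <;> simp [hδ]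
  have hind : ∀ x : ℝ, (Set.Iic θ).indicator (fun x => ENNReal.ofReal (x ^ τ)) x ^ (2 / τ) =
      (Set.Iic θ).indicator (fun x => ENNReal.ofReal (x ^ τ) ^ (2 / τ)) x := by
    intro x
    by_cases hx : x ∈ Set.Iic θ
    · rw [Set.indicator_of_mem hx, Set.indicator_of_mem hx]
    · rw [Set.indicator_of_notMem hx, Set.indicator_of_notMem hx, ENNReal.zero_rpow_of_pos hδ]
  have h1 : Measurable fun b : Bool => (if b = true then 1 else 0 : ℝ≥0∞) := .of_discrete
  have h2 : Measurable ((Set.Iic θ).indicator fun x : ℝ => ENNReal.ofReal (x ^ τ) ^ (2 / τ)) :=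
    Measurable.indicator (by fun_prop) measurableSet_Iic
  have h3 : Measurable fun x : ℝ => ENNReal.ofReal x ^ (2 / τ) := by fun_prop
  have hG : ∫⁻ x, ENNReal.ofReal x ^ (2 / τ) ∂(lawOfDensity f) = ENNReal.ofReal M := by
    rw [← hM]
    refine lintegral_congr_ae ?_
    filter_upwards [ae_pos_lawOfDensity f] with x hx
    exact ENNReal.ofReal_rpow_of_nonneg hx.le hδ.le
  have h4 : Measurable fun m : Bool × ℝ => (if m.1 = true then 1 else 0 : ℝ≥0∞) *
      ENNReal.ofReal m.2 ^ (2 / τ) := (h1.comp measurable_fst).mul (h3.comp measurable_snd)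
  have h5 : Measurable fun m : ℝ × Bool × ℝ =>
      (Set.Iic θ).indicator (fun x => ENNReal.ofReal (x ^ τ) ^ (2 / τ)) m.1 *
        ((if m.2.1 = true then 1 else 0 : ℝ≥0∞) * ENNReal.ofReal m.2.2 ^ (2 / τ)) :=
    (h2.comp measurable_fst).mul (h4.comp measurable_snd)
  simp only [markPower, ENNReal.mul_rpow_of_nonneg _ _ hδ.le, hif, hind]
  rw [markLaw, lintegral_prod_mul h1.aemeasurable h5.aemeasurable,
    lintegral_prod_mul h2.aemeasurable h4.aemeasurable,
    lintegral_prod_mul h1.aemeasurable h3.aemeasurable, lintegral_bernoulliMeasure_true,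
    lintegral_bernoulliMeasure_true, hG, lintegral_linkLaw_power hξ hθ hτ,
    ← ENNReal.ofReal_mul ε.2.1,
    ← ENNReal.ofReal_mul (div_nonneg (lowerGamma_two_nonneg (by positivity)) (by positivity)),
    ← ENNReal.ofReal_mul q.2.1]

theorem lintegral_one_sub_expNeg_mul_pathLoss {a : ℝ≥0∞} (ha : a ≠ ⊤) {τ : ℝ} (hτ : 2 < τ) :
    ∫⁻ x : Plane, (1 - expNeg (a * ENNReal.ofReal (‖x‖ ^ (-τ)))) =
      ENNReal.ofReal (Real.pi * Real.Gamma (1 - 2 / τ)) * a ^ (2 / τ) := by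
  have hδ : 0 < 1 - 2 / τ := by
    rw [sub_pos, div_lt_one (by linarith)]; exact hτ
  have hΓ := (Real.Gamma_pos_of_pos hδ).le
  have hδ' : 0 ≤ 2 / τ := div_nonneg two_pos.le (by linarith)
  rw [← ENNReal.ofReal_toReal ha]
  simp_rw [← ENNReal.ofReal_mul (ENNReal.toReal_nonneg (a := a))]
  rw [lintegral_one_sub_expNeg_pathLoss ENNReal.toReal_nonneg hτ,
    ENNReal.ofReal_rpow_of_nonneg ENNReal.toReal_nonneg hδ', ENNReal.ofReal_mul (by positivity)]

end MarkLaws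

/-! ### Interference in the network -/

section Network

variable {Ω : Type*} [MeasurableSpace Ω] {P : Measure Ω}
  {lam ξ θ τ w : ℝ} {q ε : I} {f : ℝ → ℝ} {X : ℕ → Ω → Plane} {ty : ℕ → Ω → Bool}
  {L : ℕ → Ω → ℝ} {tx : ℕ → Ω → Bool} {G : ℕ → Ω → ℝ}

theorem ae_pos_markLaw (q ε : I) (ξ : ℝ) (f : ℝ → ℝ) :
    ∀ᵐ m ∂(markLaw q ε ξ (lawOfDensity f)), 0 < m.2.1 ∧ 0 < m.2.2.2 := by
  have h1 : ∀ᵐ m ∂((linkLaw ξ).prod ((bernoulliMeasure true false ε).prod (lawOfDensity f))),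
      0 < m.1 := Measure.quasiMeasurePreserving_fst.ae (ae_pos_lawOfDensity _)
  have h2 : ∀ᵐ m ∂((linkLaw ξ).prod ((bernoulliMeasure true false ε).prod (lawOfDensity f))),
      0 < m.2.2 := Measure.quasiMeasurePreserving_snd.ae
    (Measure.quasiMeasurePreserving_snd.ae (ae_pos_lawOfDensity f))
  exact Measure.quasiMeasurePreserving_snd.ae (h1.and h2)

/-- Off a null set all link lengths and fading coefficients are positive, so `ENNReal.ofReal`
truncates nothing and the sum in `[0, ∞]` represents the real one. -/
theorem IsNetwork.ae_marks_pos (h : IsNetwork lam q ε ξ (lawOfDensity f) X ty L tx G P) :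
    ∀ᵐ ω ∂P, ∀ i, 0 < L i ω ∧ 0 < G i ω := by
  refine ae_all_iff.2 fun i => ?_
  have := ae_pos_markLaw q ε ξ f
  rw [markLaw, ← (h.mark_law i).map_eq] at this
  exact ae_of_ae_map (h.mark_law i).aemeasurable this

theorem IsNetwork.integral_fading (h : IsNetwork lam q ε ξ (lawOfDensity f) X ty L tx G P)
    (hξ : 0 < ξ) (hw : 0 ≤ w)
    (hmean : ∫⁻ x, ENNReal.ofReal x ∂(lawOfDensity f) = ENNReal.ofReal w) (i : ℕ) :
    ∫ ω, G i ω ∂P = w := by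
  -- Integrating out the other marks leaves the fading integral unchanged only because the link law
  -- has total mass one.
  have := isProbabilityMeasure_linkLaw hξ
  rw [integral_eq_lintegral_of_nonneg_ae
    (h.ae_marks_pos.mono fun ω hω => (hω i).2.le) (h.measurable_G i).aestronglyMeasurable]
  have h1 := (h.mark_law i).lintegral_comp (f := fun m => ENNReal.ofReal m.2.2.2) (by fun_prop)
  have h2 : ∫⁻ m : Bool × ℝ × Bool × ℝ, ENNReal.ofReal m.2.2.2 ∂((bernoulliMeasure true false q).prod
      ((linkLaw ξ).prod ((bernoulliMeasure true false ε).prod (lawOfDensity f)))) =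
        ∫⁻ x, ENNReal.ofReal x ∂(lawOfDensity f) := by
    rw [lintegral_prod _ (by fun_prop)]
    simp only [lintegral_const, measure_univ, mul_one]
    rw [lintegral_prod _ (by fun_prop)]
    simp only [lintegral_const, measure_univ, mul_one]
    rw [lintegral_prod _ (by fun_prop)]
    simp only [lintegral_const, measure_univ, mul_one]
  rw [h1, h2, hmean, ENNReal.toReal_ofReal hw]

/-- The interference as a sum in `[0, ∞]` over all UEs. -/
noncomputable def totalPower {Ω : Type*} (τ θ : ℝ) (X : ℕ → Ω → Plane) (ty : ℕ → Ω → Bool)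
    (L : ℕ → Ω → ℝ) (tx : ℕ → Ω → Bool) (G : ℕ → Ω → ℝ) (ω : Ω) : ℝ≥0∞ :=
  ∑' i, markPower θ τ (ty i ω, L i ω, tx i ω, G i ω) * ENNReal.ofReal (‖X i ω‖ ^ (-τ))

theorem IsNetwork.measurable_mark {fading : Measure ℝ}
    (h : IsNetwork lam q ε ξ fading X ty L tx G P) (i : ℕ) :
    Measurable fun ω => (ty i ω, L i ω, tx i ω, G i ω) :=
  (h.measurable_ty i).prodMk ((h.measurable_L i).prodMk
    ((h.measurable_tx i).prodMk (h.measurable_G i)))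

theorem IsNetwork.measurable_totalPower {fading : Measure ℝ}
    (h : IsNetwork lam q ε ξ fading X ty L tx G P) (τ θ : ℝ) :
    Measurable (totalPower τ θ X ty L tx G) := by
  refine Measurable.tsum fun i => ((measurable_markPower θ τ).comp (h.measurable_mark i)).mul ?_
  have := h.ppp.measurable i
  fun_prop

theorem IsNetwork.lintegral_expNeg_totalPower [IsProbabilityMeasure P] {M s : ℝ}
    (h : IsNetwork lam q ε ξ (lawOfDensity f) X ty L tx G P) (hlam : 0 ≤ lam) (hξ : 0 < ξ)
    (hθ : 0 < θ) (hτ : 2 < τ) (hM0 : 0 ≤ M)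
    (hM : ∫⁻ x, ENNReal.ofReal (x ^ (2 / τ)) ∂(lawOfDensity f) = ENNReal.ofReal M) (hs : 0 ≤ s) :
    ∫⁻ ω, expNeg (ENNReal.ofReal s * totalPower τ θ X ty L tx G ω) ∂P =
      ENNReal.ofReal (Real.exp
        (-(q * ε * lam / xiHat ξ θ * (Real.Gamma (1 - 2 / τ) * M)) * s ^ (2 / τ))) := by
  have hτ0 : 0 < τ := by linarith
  have hδ : 0 < 1 - 2 / τ := by
    rw [sub_pos, div_lt_one hτ0]; exact hτ
  have hδ' : 0 ≤ 2 / τ := by positivity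
  have hΓ := (Real.Gamma_pos_of_pos hδ).le
  let ψ : Plane × (Bool × ℝ × Bool × ℝ) → ℝ≥0∞ := fun p =>
    ENNReal.ofReal s * markPower θ τ p.2 * ENNReal.ofReal (‖p.1‖ ^ (-τ))
  have hψ : Measurable ψ :=
    (((measurable_markPower θ τ).comp measurable_snd).const_mul _).mul (by fun_prop)
  have key := h.ppp.lintegral_expNeg_tsum_marked hlam h.measurable_mark h.mark_law h.mark_indep
    h.mark_indep_location hψ
  have hsum : ∀ ω, ENNReal.ofReal s * totalPower τ θ X ty L tx G ω =
      ∑' i, ψ (X i ω, (ty i ω, L i ω, tx i ω, G i ω)) := by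
    intro ω
    rw [totalPower, ← ENNReal.tsum_mul_left]
    exact tsum_congr fun i => (mul_assoc _ _ _).symm
  simp_rw [hsum]
  rw [key, ← markLaw]
  have hsf : SFinite (markLaw q ε ξ (lawOfDensity f)) := by unfold markLaw; infer_instance
  -- For a fixed mark the plane integral is explicit and depends on the mark only through a power,
  -- so it is carried out before the average over marks.
  rw [lintegral_lintegral_swap
    (measurable_const.sub (measurable_expNeg.comp hψ)).aemeasurable]
  have hin : ∀ m, ∫⁻ x : Plane, (1 - expNeg (ψ (x, m))) =
      ENNReal.ofReal (Real.pi * Real.Gamma (1 - 2 / τ) * s ^ (2 / τ)) *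
        markPower θ τ m ^ (2 / τ) := by
    intro m
    rw [lintegral_one_sub_expNeg_mul_pathLoss
      (ENNReal.mul_ne_top ENNReal.ofReal_ne_top (markPower_ne_top θ τ m)) hτ,
      ENNReal.mul_rpow_of_nonneg _ _ hδ', ENNReal.ofReal_rpow_of_nonneg hs hδ',
      ENNReal.ofReal_mul (mul_nonneg Real.pi_pos.le hΓ), mul_assoc]
  simp_rw [hin]
  have hlow := lowerGamma_two_nonneg (x := ξ * Real.pi * θ ^ 2) (by positivity)
  have hq := q.2.1
  have hε := ε.2.1
  rw [lintegral_const_mul _ ((measurable_markPower θ τ).pow_const _),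
    lintegral_markPower_rpow hξ hθ hτ0 hM, ← ENNReal.ofReal_mul (by positivity),
    ← ENNReal.ofReal_mul hlam, expNeg_ofReal (by positivity)]
  -- The `π` of the disc area cancels the `π` in `γ(2, ξπθ²)/(ξπ)`, which leaves `1/ξ̂`.
  congr 2
  rw [xiHat, div_div_eq_mul_div]
  field_simp

/-- For `s > 0` the integrand is at most the indicator of finiteness, since it vanishes where the
sum is `⊤`. Hence the Laplace transform bounds the probability of finiteness from below, and it
tends to `1` as `s → 0+`. -/
theorem IsNetwork.ae_totalPower_lt_top [IsProbabilityMeasure P] {c δ : ℝ} {fading : Measure ℝ}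
    (h : IsNetwork lam q ε ξ fading X ty L tx G P) (hδ : 0 < δ)
    (hlap : ∀ s : ℝ, 0 ≤ s → ∫⁻ ω, expNeg (ENNReal.ofReal s * totalPower τ θ X ty L tx G ω) ∂P =
      ENNReal.ofReal (Real.exp (-c * s ^ δ))) :
    ∀ᵐ ω ∂P, totalPower τ θ X ty L tx G ω < ⊤ := by
  have hS : MeasurableSet {ω | totalPower τ θ X ty L tx G ω < ⊤} :=
    measurableSet_lt (h.measurable_totalPower τ θ) measurable_const
  have hle : ∀ s : ℝ, 0 < s → ENNReal.ofReal (Real.exp (-c * s ^ δ)) ≤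
      P {ω | totalPower τ θ X ty L tx G ω < ⊤} := by
    intro s hs
    rw [← hlap s hs.le, ← lintegral_indicator_one hS]
    refine lintegral_mono fun ω => ?_
    by_cases hω : totalPower τ θ X ty L tx G ω < ⊤
    · rw [Set.indicator_of_mem (by exact hω)]
      exact expNeg_le_one _
    · rw [not_lt_top_iff.1 hω, ENNReal.mul_top (by simpa using hs), expNeg_top]
      exact zero_le
  have hlim : Tendsto (fun s : ℝ => ENNReal.ofReal (Real.exp (-c * s ^ δ))) (𝓝[>] 0) (𝓝 1) := by
    have hc : Continuous fun s : ℝ => ENNReal.ofReal (Real.exp (-c * s ^ δ)) :=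
      ENNReal.continuous_ofReal.comp (Real.continuous_exp.comp
        ((Real.continuous_rpow_const hδ.le).const_mul _))
    have := (hc.tendsto 0).mono_left (nhdsWithin_le_nhds (s := Set.Ioi 0))
    simpa [Real.zero_rpow hδ.ne'] using this
  have h1 : 1 ≤ P {ω | totalPower τ θ X ty L tx G ω < ⊤} :=
    le_of_tendsto hlim (eventually_mem_nhdsWithin.mono fun s hs => hle s hs)
  exact (mem_ae_iff_prob_eq_one hS).2 (le_antisymm prob_le_one h1)

theorem totalPower_eq_tsum_indicator {Ω : Type*} {X : ℕ → Ω → Plane} {ty : ℕ → Ω → Bool}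
    {L : ℕ → Ω → ℝ} {tx : ℕ → Ω → Bool} {G : ℕ → Ω → ℝ} {τ : ℝ} (θ : ℝ) (hτ : 0 < τ) {ω : Ω}
    (hω : ∀ i, 0 < L i ω ∧ 0 < G i ω) :
    totalPower τ θ X ty L tx G ω = ∑' i, ENNReal.ofReal
      ((interferers θ X ty L tx ω).indicator (receivedPower τ X L G ω) i) := by
  refine tsum_congr fun i => ?_
  obtain ⟨hL, hG⟩ := hω i
  by_cases hi : i ∈ interferers θ X ty L tx ω
  · obtain ⟨h1, h2, h3, -⟩ := id hi
    rw [Set.indicator_of_mem hi, receivedPower, ENNReal.ofReal_mul (by positivity),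
      ENNReal.ofReal_mul (by positivity)]
    simp [markPower, h1, h2, h3]
  · rw [Set.indicator_of_notMem hi, ENNReal.ofReal_zero]
    by_cases hX : X i ω = 0
    -- A UE at the origin is excluded from the interferers; in `totalPower` it contributes `0`
    -- through the convention `0 ^ (-τ) = 0`.
    · simp [hX, Real.zero_rpow (neg_ne_zero.2 hτ.ne')]
    · by_cases h1 : ty i ω = true
      · by_cases h2 : L i ω ≤ θ
        · have h3 : tx i ω ≠ true := fun h3 => hi ⟨h1, h2, h3, hX⟩
          simp [markPower, h3]
        · simp [markPower, h2]
      · simp [markPower, h1]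

theorem summable_receivedPower_of_totalPower_lt_top {Ω : Type*} {X : ℕ → Ω → Plane}
    {ty : ℕ → Ω → Bool} {L : ℕ → Ω → ℝ} {tx : ℕ → Ω → Bool} {G : ℕ → Ω → ℝ} {τ θ : ℝ}
    (hτ : 0 < τ) {ω : Ω} (hω : ∀ i, 0 < L i ω ∧ 0 < G i ω)
    (hfin : totalPower τ θ X ty L tx G ω < ⊤) :
    (Summable fun i : interferers θ X ty L tx ω => receivedPower τ X L G ω i) ∧
      0 ≤ interference τ θ X ty L tx G ω ∧
      totalPower τ θ X ty L tx G ω = ENNReal.ofReal (interference τ θ X ty L tx G ω) := by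
  have hnn : ∀ i, 0 ≤ (interferers θ X ty L tx ω).indicator (receivedPower τ X L G ω) i :=
    fun i => Set.indicator_nonneg (fun i _ => by
      obtain ⟨hL, hG⟩ := hω i
      unfold receivedPower
      positivity) i
  rw [totalPower_eq_tsum_indicator θ hτ hω] at hfin ⊢
  have hsum := ENNReal.summable_toReal hfin.ne
  simp only [ENNReal.toReal_ofReal (hnn _)] at hsum
  have hI : interference τ θ X ty L tx G ω =
      ∑' i, (interferers θ X ty L tx ω).indicator (receivedPower τ X L G ω) i :=
    tsum_subtype (interferers θ X ty L tx ω) (receivedPower τ X L G ω)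
  rw [hI]
  exact ⟨summable_subtype_iff_indicator.2 hsum, tsum_nonneg hnn,
    (ENNReal.ofReal_tsum_of_nonneg hnn hsum).symm⟩

/-- Almost sure convergence and Laplace transform of the interference, in terms of the moment of
order `2 / τ` of the fading coefficient. -/
theorem IsNetwork.interference_laplace [IsProbabilityMeasure P] {M : ℝ}
    (h : IsNetwork lam q ε ξ (lawOfDensity f) X ty L tx G P) (hlam : 0 ≤ lam) (hξ : 0 < ξ)
    (hθ : 0 < θ) (hτ : 2 < τ) (hM0 : 0 ≤ M)
    (hM : ∫⁻ x, ENNReal.ofReal (x ^ (2 / τ)) ∂(lawOfDensity f) = ENNReal.ofReal M) :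
    (∀ᵐ ω ∂P, Summable fun i : interferers θ X ty L tx ω => receivedPower τ X L G ω i) ∧
      ∀ s : ℝ, 0 ≤ s → laplaceTransform (interference τ θ X ty L tx G) P s =
        Real.exp (-(q * ε * lam / xiHat ξ θ * (Real.Gamma (1 - 2 / τ) * M)) * s ^ (2 / τ)) := by
  have hτ0 : 0 < τ := by linarith
  have hlap := fun (s : ℝ) (hs : 0 ≤ s) =>
    h.lintegral_expNeg_totalPower hlam hξ hθ hτ hM0 hM hs
  -- A real `tsum` is `0` when it diverges, so almost sure finiteness must be known before
  -- `interference` can replace the sum in `[0, ∞]`.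
  have hae : ∀ᵐ ω ∂P, (Summable fun i : interferers θ X ty L tx ω => receivedPower τ X L G ω i) ∧
      0 ≤ interference τ θ X ty L tx G ω ∧
      totalPower τ θ X ty L tx G ω = ENNReal.ofReal (interference τ θ X ty L tx G ω) := by
    filter_upwards [h.ae_marks_pos, h.ae_totalPower_lt_top (div_pos two_pos hτ0) hlap]
      with ω hω hfin
    exact summable_receivedPower_of_totalPower_lt_top hτ0 hω hfin
  refine ⟨hae.mono fun ω hω => hω.1, fun s hs => ?_⟩
  have hint : laplaceTransform (interference τ θ X ty L tx G) P s =
      ∫ ω, (expNeg (ENNReal.ofReal s * totalPower τ θ X ty L tx G ω)).toReal ∂P := by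
    refine integral_congr_ae ?_
    filter_upwards [hae] with ω hω
    rw [hω.2.2, ← ENNReal.ofReal_mul hs, expNeg_ofReal (mul_nonneg hs hω.2.1),
      ENNReal.toReal_ofReal (Real.exp_nonneg _), neg_mul]
  have hmeas : Measurable fun ω => expNeg (ENNReal.ofReal s * totalPower τ θ X ty L tx G ω) :=
    measurable_expNeg.comp ((h.measurable_totalPower τ θ).const_mul _)
  rw [hint, integral_toReal hmeas.aemeasurable (.of_forall fun ω => (expNeg_ne_top _).lt_top),
    hlap s hs, ENNReal.toReal_ofReal (Real.exp_nonneg _)]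

end Network

/-! ### Matching the constants and conclusion -/

theorem cKappaMu_eq {δ : ℝ} (hδ : 0 < δ) (hδ1 : δ < 1) (lam q ε ξ θ κ μ w : ℝ) :
    cKappaMu lam q ε ξ θ κ μ w δ = q * ε * lam / xiHat ξ θ * (Real.Gamma (1 - δ) *
      ((w / ((1 + κ) * μ)) ^ δ * (Real.exp (-(μ * κ)) *
        (Real.Gamma (μ + δ) / Real.Gamma μ) * kummer (μ + δ) μ (μ * κ)))) := by
  have h := realBinom_mul_inv_nsinc (m := μ) hδ hδ1
  calc cKappaMu lam q ε ξ θ κ μ w δ = q * ε * lam / xiHat ξ θ * ((w / ((1 + κ) * μ)) ^ δ *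
        ((Real.exp (μ * κ))⁻¹ * kummer (μ + δ) μ (μ * κ))) *
          (realBinom (μ + δ - 1) δ / nsinc δ) := by
        rw [cKappaMu, ← div_div]; ring
    _ = _ := by rw [h, Real.exp_neg]; ring

theorem cEtaMu_eq {δ : ℝ} (hδ : 0 < δ) (hδ1 : δ < 1) (lam q ε ξ θ η μ w : ℝ) :
    cEtaMu lam q ε ξ θ η μ w δ = q * ε * lam / xiHat ξ θ * (Real.Gamma (1 - δ) *
      ((w / (2 * μ * etaSmallH η)) ^ δ * ((etaSmallH η ^ μ)⁻¹ *
        (Real.Gamma (2 * μ + δ) / Real.Gamma (2 * μ)) *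
          ordinaryHypergeometric (μ + δ / 2 + 1 / 2) (μ + δ / 2) (μ + 1 / 2)
            ((etaBigH η / etaSmallH η) ^ 2)))) := by
  have h := realBinom_mul_inv_nsinc (m := 2 * μ) hδ hδ1
  calc cEtaMu lam q ε ξ θ η μ w δ = q * ε * lam / xiHat ξ θ *
        ((w / (2 * μ * etaSmallH η)) ^ δ * ((etaSmallH η ^ μ)⁻¹ *
          ordinaryHypergeometric (μ + δ / 2 + 1 / 2) (μ + δ / 2) (μ + 1 / 2)
            ((etaBigH η / etaSmallH η) ^ 2))) * (realBinom (2 * μ + δ - 1) δ / nsinc δ) := by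
        rw [cEtaMu, ← div_div]; ring
    _ = _ := by rw [h]; ring

theorem kummer_nonneg {a b x : ℝ} (ha : 0 < a) (hb : 0 < b) (hx : 0 ≤ x) : 0 ≤ kummer a b x :=
  tsum_nonneg fun n => by
    have h1 := (ascPochhammer_pos n a ha).le
    have h2 := (ascPochhammer_pos n b hb).le
    positivity

theorem ordinaryHypergeometric_nonneg {a b c z : ℝ} (ha : 0 < a) (hb : 0 < b) (hc : 0 < c)
    (hz : 0 ≤ z) (hz1 : |z| < 1) : 0 ≤ ordinaryHypergeometric a b c z :=
  (hasSum_ordinaryHypergeometric ha hb hc hz1).nonneg fun n => by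
    have h1 := (ascPochhammer_pos n a ha).le
    have h2 := (ascPochhammer_pos n b hb).le
    have h3 := (ascPochhammer_pos n c hc).le
    positivity

end D2D

theorem mainTheorem4 {Ω : Type*} [MeasurableSpace Ω] (P : Measure Ω) [IsProbabilityMeasure P]
    (lam ξ θ τ w : ℝ) (q ε : I) (hlam : 0 < lam) (hξ : 0 < ξ) (hθ : 0 < θ) (hτ : 2 < τ)
    (hw : 0 < w)
    (X : ℕ → Ω → D2D.Plane) (ty : ℕ → Ω → Bool) (L : ℕ → Ω → ℝ) (tx : ℕ → Ω → Bool)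
    (G : ℕ → Ω → ℝ) :
    (∀ κ μ : ℝ, 0 < κ → 0 < μ →
      D2D.IsNetwork lam q ε ξ (D2D.kappaMuLaw κ μ w) X ty L tx G P →
        (∀ i, ∫ ω, G i ω ∂P = w) ∧
        (∀ᵐ ω ∂P, Summable fun i : D2D.interferers θ X ty L tx ω =>
          D2D.receivedPower τ X L G ω i) ∧
        ∀ s : ℝ, 0 ≤ s →
          D2D.laplaceTransform (D2D.interference τ θ X ty L tx G) P s =
            Real.exp (-D2D.cKappaMu lam q ε ξ θ κ μ w (2 / τ) * s ^ (2 / τ))) ∧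
    (∀ η μ : ℝ, 0 < η → 0 < μ →
      D2D.IsNetwork lam q ε ξ (D2D.etaMuLaw η μ w) X ty L tx G P →
        (∀ i, ∫ ω, G i ω ∂P = w) ∧
        (∀ᵐ ω ∂P, Summable fun i : D2D.interferers θ X ty L tx ω =>
          D2D.receivedPower τ X L G ω i) ∧
        ∀ s : ℝ, 0 ≤ s →
          D2D.laplaceTransform (D2D.interference τ θ X ty L tx G) P s =
            Real.exp (-D2D.cEtaMu lam q ε ξ θ η μ w (2 / τ) * s ^ (2 / τ))) := by
  have hτ0 : 0 < τ := by linarith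
  have hδ : 0 < 2 / τ := by positivity
  have hδ1 : 2 / τ < 1 := (div_lt_one hτ0).2 hτ
  refine ⟨fun κ μ hκ hμ h => ⟨fun i => ?_, ?_⟩, fun η μ hη hμ h => ⟨fun i => ?_, ?_⟩⟩
  · exact h.integral_fading hξ hw.le (D2D.lintegral_id_kappaMuLaw hκ hμ hw) i
  -- Nonnegativity of the special function makes the real moment nonnegative, so that
  -- `ENNReal.ofReal` loses nothing.
  · have hk : 0 ≤ D2D.kummer (μ + 2 / τ) μ (μ * κ) :=
      D2D.kummer_nonneg (by positivity) hμ (by positivity)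
    rw [D2D.cKappaMu_eq hδ hδ1]
    exact h.interference_laplace hlam.le hξ hθ hτ (by positivity)
      (D2D.lintegral_rpow_kappaMuLaw hκ hμ hw hδ.le)
  · exact h.integral_fading hξ hw.le (D2D.lintegral_id_etaMuLaw hη hμ hw) i
  · have hh := D2D.etaSmallH_pos hη
    have hF := D2D.ordinaryHypergeometric_nonneg (a := μ + 2 / τ / 2 + 1 / 2) (b := μ + 2 / τ / 2)
      (c := μ + 1 / 2) (by positivity) (by positivity) (by positivity) (sq_nonneg _)
      (D2D.abs_etaRatio_sq_lt_one hη)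
    rw [D2D.cEtaMu_eq hδ hδ1]
    exact h.interference_laplace hlam.le hξ hθ hτ (by positivity)
      (D2D.lintegral_rpow_etaMuLaw hη hμ hw hδ.le)
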